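/- Let $N\ge 3$, $2^*=\frac{2N}{N-2}$, let $\Omega\subset\mathbb R^N$ be a bounded domain with smooth boundary, let $a_1,\dots,a_k\in\Omega$ be pairwise distinct and $h_1,\dots,h_k\in C^1(\mathbb S^{N-1})$. Let $\mathcal D^{1,2}(\mathbb R^N)$ be the closure of $C_c^\infty(\mathbb R^N)$ in the norm $\|\nabla u\|_{L^2(\mathbb R^N)}$, and extend functions in $H^1_0(\Omega)$ by zero outside $\Omega$. Put $$\mathcal Q_\Omega(u)=\int_\Omega|\nabla u|^2\,dx-\sum_{i=1}^k\int_{\mathbb R^N}\frac{h_i\big(\frac{x-a_i}{|x-a_i|}\big)}{|x-a_i|^2}\,u^2\,dx,\qquad S_\Omega(h_1,\dots,h_k)=\inf_{u\in H^1_0(\Omega)\setminus\{0\}}\frac{\mathcal Q_\Omega(u)}{\|u\|_{L^{2^*}(\Omega)}^2},$$ $$S=\inf_{u\in\mathcal D^{1,2}(\mathbb R^N)\setminus\{0\}}\frac{\int_{\mathbb R^N}|\nabla u|^2dx}{\|u\|_{L^{2^*}(\mathbb R^N)}^2},\qquad S(h)=\inf_{u\in\mathcal D^{1,2}(\mathbb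 R^N)\setminus\{0\}}\frac{\int_{\mathbb R^N}\big[|\nabla u|^2-\frac{h(x/|x|)}{|x|^2}u^2\big]dx}{\|u\|_{L^{2^*}(\mathbb R^N)}^2},$$ $$S(h_1,\dots,h_k)=\inf_{u\in\mathcal D^{1,2}(\mathbb R^N)\setminus\{0\}}\frac{\int_{\mathbb R^N}|\nabla u|^2dx-\sum_{i=1}^k\int_{\mathbb R^N}\frac{h_i\big(\frac{x-a_i}{|x-a_i|}\big)}{|x-a_i|^2}u^2\,dx}{\|u\|_{L^{2^*}(\mathbb R^N)}^2}.$$ Assume that $\mathcal Q_\Omega$ is positive definite, i.e. $\mathcal Q_\Omega(u)\ge \kappa\int_\Omega|\nabla u|^2dx$ for some $\kappa>0$ and all $u\in H^1_0(\Omega)$. Let $\Lambda=S_\Omega(h_1,\dots,h_k)$ or, if the infimum $S(h_1,\dots,h_k)$ is finite, $\Lambda=S(h_1,\dots,h_k)$, and let $J_\Omega:H^1_0(\Omega)\to\mathbb R$, $$J_\Omega(v)=\tfrac12\mathcal Q_\Omega(v)-\frac{\Lambda}{2^*}\int_\Omega|v|^{2^*}dx .$$ Let $\{u_n\}\subset H^1_0(\Omega)$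 be a Palais–Smale sequence for $J_\Omega$ at a level $c\in\mathbb R$, i.e. $J_\Omega(u_n)\to c$ and $J_\Omega'(u_n)\to0$ in the dual space $(H^1_0(\Omega))^\star$, where $J_\Omega'$ is the Fréchet derivative. If $$c<\frac1N\,S_\Omega(h_1,\dots,h_k)^{1-\frac N2}\,\min\{S,S(h_1),\dots,S(h_k)\}^{N/2},$$ then $\{u_n\}$ has a subsequence converging strongly in $H^1_0(\Omega)$. -/

import Mathlib

open MeasureTheory Filter Topology Set
open scoped ContDiff Manifold ENNReal Gradient

noncomputable section

namespace MultiHardy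

/-- Euclidean space `ℝ^N`. -/
abbrev Euc (N : ℕ) : Type := EuclideanSpace ℝ (Fin N)

/-- The unit sphere `𝕊^{N-1}` of `ℝ^N`. -/
abbrev Sph (N : ℕ) : Type := Metric.sphere (0 : Euc N) 1

/-- Lets Mathlib regard `𝕊^{N-1}` as a smooth manifold of dimension `N - 1`. -/
instance factFinrank (N : ℕ) [hN : Fact (3 ≤ N)] :
    Fact (Module.finrank ℝ (Euc N) = N - 1 + 1) :=
  ⟨by have := hN.out; simp only [finrank_euclideanSpace, Fintype.card_fin]; omega⟩

/-- The critical Sobolev exponent `2^* = 2N / (N - 2)`. -/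
def twoStar (N : ℕ) : ℝ := 2 * N / (N - 2)

instance factTwoStar (N : ℕ) [hN : Fact (3 ≤ N)] :
    Fact ((1 : ℝ≥0∞) ≤ ENNReal.ofReal (twoStar N)) :=
  ⟨by
    have h3 : (3 : ℝ) ≤ N := by exact_mod_cast hN.out
    rw [ENNReal.one_le_ofReal, twoStar, le_div_iff₀ (by linarith)]
    linarith⟩

/-! ### Function spaces

An element of the spaces below is a pair `w = (u, ∇u)`: `w.fst` is the function `u` and `w.snd` is
its weak gradient. Functions on `Ω` are regarded as functions on `ℝ^N` vanishing outside `Ω`. -/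

/-- The pairs `(u, G)` with `u ∈ L^p(ℝ^N)` and `G ∈ L^2(ℝ^N; ℝ^N)`, with the norm
`(‖u‖_{L^p}² + ‖G‖_{L^2}²)^{1/2}`. -/
abbrev PairSpace (N : ℕ) (p : ℝ≥0∞) [Fact (1 ≤ p)] : Type :=
  WithLp 2 (Lp ℝ p (volume : Measure (Euc N)) × Lp (Euc N) 2 (volume : Measure (Euc N)))

/-- The space of the pairs `(φ, ∇φ)` with `φ ∈ C_c^∞(Ω)`. -/
def testPairs (N : ℕ) (p : ℝ≥0∞) [Fact (1 ≤ p)] (Ω : Set (Euc N)) :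
    Submodule ℝ (PairSpace N p) where
  carrier := {w | ∃ φ : Euc N → ℝ, ContDiff ℝ ∞ φ ∧ HasCompactSupport φ ∧ tsupport φ ⊆ Ω ∧
    w.fst =ᵐ[volume] φ ∧ w.snd =ᵐ[volume] fun x => ∇ φ x}
  zero_mem' := by
    refine ⟨0, contDiff_const, HasCompactSupport.zero, by simp, ?_, ?_⟩
    · exact Lp.coeFn_zero _ _ _
    · refine (Lp.coeFn_zero _ _ _).trans (Eventually.of_forall fun x => ?_)
      simp [gradient]
  add_mem' := by
    rintro w v ⟨φ, h1, h2, h3, h4, h5⟩ ⟨ψ, k1, k2, k3, k4, k5⟩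
    refine ⟨φ + ψ, h1.add k1, h2.add k2,
      (tsupport_add φ ψ).trans (union_subset h3 k3), ?_, ?_⟩
    · exact (Lp.coeFn_add _ _).trans (h4.add k4)
    · refine (Lp.coeFn_add _ _).trans ((h5.add k5).trans (Eventually.of_forall fun x => ?_))
      have e1 := (h1.differentiable (by simp)).differentiableAt (x := x)
      have e2 := (k1.differentiable (by simp)).differentiableAt (x := x)
      simp [gradient, fderiv_add e1 e2]
  smul_mem' := by
    rintro c w ⟨φ, h1, h2, h3, h4, h5⟩
    refine ⟨c • φ, h1.const_smul c, h2.smul_left (f := fun _ => c),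
      (tsupport_smul_subset_right (fun _ => c) φ).trans h3, ?_, ?_⟩
    · exact (Lp.coeFn_smul _ _).trans (h4.const_smul c)
    · refine (Lp.coeFn_smul _ _).trans ((h5.const_smul c).trans (Eventually.of_forall fun x => ?_))
      have e1 := (h1.differentiable (by simp)).differentiableAt (x := x)
      simp [gradient, fderiv_const_smul e1]

/-- `H^1_0(Ω)`: the closure of `C_c^∞(Ω)` in the norm `(‖u‖_{L^2}² + ‖∇u‖_{L^2}²)^{1/2}`. -/
abbrev H10 (N : ℕ) (Ω : Set (Euc N)) : Submodule ℝ (PairSpace N 2) :=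
  (testPairs N 2 Ω).topologicalClosure

/-- `D^{1,2}(ℝ^N)`: the closure of `C_c^∞(ℝ^N)` in the norm `‖∇u‖_{L^2}`. By Sobolev's inequality
this norm is equivalent on `C_c^∞(ℝ^N)` to `(‖u‖_{L^{2^*}}² + ‖∇u‖_{L^2}²)^{1/2}`, and the closure
is realized concretely as a space of functions in `L^{2^*}` with gradient in `L^2`. -/
abbrev D12 (N : ℕ) [Fact (3 ≤ N)] : Submodule ℝ (PairSpace N (ENNReal.ofReal (twoStar N))) :=
  (testPairs N (ENNReal.ofReal (twoStar N)) univ).topologicalClosure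

/-! ### Potentials, quadratic forms, best constants -/

/-- The potential `h(x/|x|) / |x|²` (with the irrelevant value `0` at `x = 0`). -/
def angularPotential {N : ℕ} (h : Sph N → ℝ) (x : Euc N) : ℝ :=
  if hx : x = 0 then 0
  else h ⟨‖x‖⁻¹ • x, by simp [norm_smul, norm_ne_zero_iff.mpr hx]⟩ / ‖x‖ ^ 2

/-- The best constant `S` in Sobolev's inequality, `inf ‖∇u‖_{L^2}² / ‖u‖_{L^{2^*}}²` over
`u ∈ D^{1,2}(ℝ^N) \ {0}`. -/
def sobolevS (N : ℕ) [Fact (3 ≤ N)] : ℝ :=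
  ⨅ w : {w : D12 N // w ≠ 0},
    (∫ x, ‖w.1.1.snd x‖ ^ 2) / (∫ x, |w.1.1.fst x| ^ twoStar N) ^ (2 / twoStar N)

/-- The constant `S(h)` of a single singularity. -/
def singleS {N : ℕ} [Fact (3 ≤ N)] (h : Sph N → ℝ) : ℝ :=
  ⨅ w : {w : D12 N // w ≠ 0},
    (∫ x, (‖w.1.1.snd x‖ ^ 2 - angularPotential h x * w.1.1.fst x ^ 2)) /
      (∫ x, |w.1.1.fst x| ^ twoStar N) ^ (2 / twoStar N)

/-- The Rayleigh quotient of `w ∈ D^{1,2}(ℝ^N)` whose infimum is `S(h_1, …, h_k)`. -/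
def wholeQuotient {N k : ℕ} [Fact (3 ≤ N)] (a : Fin k → Euc N) (h : Fin k → Sph N → ℝ)
    (w : D12 N) : ℝ :=
  ((∫ x, ‖w.1.snd x‖ ^ 2) - ∑ i, ∫ x, angularPotential (h i) (x - a i) * w.1.fst x ^ 2) /
    (∫ x, |w.1.fst x| ^ twoStar N) ^ (2 / twoStar N)

/-- The constant `S(h_1, …, h_k)` on the whole space. -/
def wholeS {N k : ℕ} [Fact (3 ≤ N)] (a : Fin k → Euc N) (h : Fin k → Sph N → ℝ) : ℝ :=
  ⨅ w : {w : D12 N // w ≠ 0}, wholeQuotient a h w.1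

/-- The quadratic form `Q_Ω` on `H^1_0(Ω)`. -/
def formQ {N k : ℕ} (Ω : Set (Euc N)) (a : Fin k → Euc N) (h : Fin k → Sph N → ℝ)
    (w : H10 N Ω) : ℝ :=
  (∫ x in Ω, ‖w.1.snd x‖ ^ 2) - ∑ i, ∫ x, angularPotential (h i) (x - a i) * w.1.fst x ^ 2

/-- `Q_Ω` is positive definite:
the infimum of `Q_Ω(u) / ‖∇u‖_{L^2}²` over `u ∈ H^1_0(Ω) \ {0}` is positive. -/
def FormPosDef {N k : ℕ} (Ω : Set (Euc N)) (a : Fin k → Euc N) (h : Fin k → Sph N → ℝ) : Prop :=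
  ∃ c : ℝ, 0 < c ∧ ∀ w : H10 N Ω, c * (∫ x in Ω, ‖w.1.snd x‖ ^ 2) ≤ formQ Ω a h w

/-- The constant `S_Ω(h_1, …, h_k)`. -/
def domainS {N k : ℕ} (Ω : Set (Euc N)) (a : Fin k → Euc N) (h : Fin k → Sph N → ℝ) : ℝ :=
  ⨅ w : {w : H10 N Ω // w ≠ 0},
    formQ Ω a h w.1 / (∫ x in Ω, |w.1.1.fst x| ^ twoStar N) ^ (2 / twoStar N)

/-- The functional `J_Ω(v) = Q_Ω(v)/2 - (Λ/2^*) ∫_Ω |v|^{2^*}` with coefficient `Λ`. -/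
def energyJ {N k : ℕ} (Ω : Set (Euc N)) (a : Fin k → Euc N) (h : Fin k → Sph N → ℝ) (Λ : ℝ)
    (w : H10 N Ω) : ℝ :=
  1 / 2 * formQ Ω a h w - Λ / twoStar N * ∫ x in Ω, |w.1.fst x| ^ twoStar N

/-- `min {S, S(h_1), …, S(h_k)}`. -/
def minS {N k : ℕ} [Fact (3 ≤ N)] (h : Fin k → Sph N → ℝ) : ℝ :=
  (insert (sobolevS N) (Finset.univ.image fun i => singleS (h i))).min' (Finset.insert_nonempty _ _)

/-! ### Domains -/

/-- `Ω` is a bounded domain with smooth boundary: near each boundary point, `Ω` is the negativity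
set of a smooth function without critical points. -/
structure IsBoundedSmoothDomain {N : ℕ} (Ω : Set (Euc N)) : Prop where
  isOpen : IsOpen Ω
  isConnected : IsConnected Ω
  isBounded : Bornology.IsBounded Ω
  smooth_boundary : ∀ x ∈ frontier Ω, ∃ U : Set (Euc N), IsOpen U ∧ x ∈ U ∧
    ∃ ρ : Euc N → ℝ, ContDiffOn ℝ ∞ ρ U ∧ (∀ y ∈ U, fderiv ℝ ρ y ≠ 0) ∧
      Ω ∩ U = {y ∈ U | ρ y < 0}

end MultiHardy

end

open MultiHardy

noncomputable section

namespace MultiHardy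

section

/-- `φ ∈ C_c^∞(Ω)`. -/
structure IsTest {N : ℕ} (Ω : Set (Euc N)) (φ : Euc N → ℝ) : Prop where
  smooth : ContDiff ℝ ∞ φ
  compact : HasCompactSupport φ
  supp : tsupport φ ⊆ Ω

variable {N : ℕ} {Ω : Set (Euc N)} {φ : Euc N → ℝ}

lemma norm_gradient (φ : Euc N → ℝ) (x : Euc N) : ‖∇ φ x‖ = ‖fderiv ℝ φ x‖ := by
  simp [gradient]

lemma IsTest.differentiable (h : IsTest Ω φ) : Differentiable ℝ φ :=
  h.smooth.differentiable (by simp)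

lemma IsTest.continuous (h : IsTest Ω φ) : Continuous φ := h.smooth.continuous

lemma IsTest.continuous_gradient (h : IsTest Ω φ) : Continuous fun x => ∇ φ x :=
  (InnerProductSpace.toDual ℝ (Euc N)).symm.continuous.comp
    (h.smooth.continuous_fderiv (by simp))

lemma IsTest.hasCompactSupport_gradient (h : IsTest Ω φ) :
    HasCompactSupport fun x => ∇ φ x :=
  (h.compact.fderiv (𝕜 := ℝ)).comp_left (g := (InnerProductSpace.toDual ℝ (Euc N)).symm) (by simp)

lemma IsTest.mono {Ω' : Set (Euc N)} (h : IsTest Ω φ) (hΩ : Ω ⊆ Ω') : IsTest Ω' φ :=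
  ⟨h.smooth, h.compact, h.supp.trans hΩ⟩

lemma IsTest.memLp (h : IsTest Ω φ) (p : ℝ≥0∞) : MemLp φ p volume :=
  h.continuous.memLp_of_hasCompactSupport h.compact

lemma IsTest.memLp_gradient (h : IsTest Ω φ) (p : ℝ≥0∞) :
    MemLp (fun x => ∇ φ x) p volume :=
  h.continuous_gradient.memLp_of_hasCompactSupport h.hasCompactSupport_gradient

/-- The closure of the pairs `(φ, ∇φ)`, `φ ∈ C_c^∞(Ω)`, in `L^p × L^2`. -/
abbrev TestClosure (N : ℕ) (p : ℝ≥0∞) [Fact (1 ≤ p)] (Ω : Set (Euc N)) :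
    Submodule ℝ (PairSpace N p) :=
  (testPairs N p Ω).topologicalClosure

variable {p : ℝ≥0∞} [Fact (1 ≤ p)]

/-- `w = (φ, ∇φ)` almost everywhere, with `φ ∈ C_c^∞(Ω)`. -/
structure IsPair (Ω : Set (Euc N)) (w : PairSpace N p) (φ : Euc N → ℝ) : Prop where
  test : IsTest Ω φ
  fst : w.fst =ᵐ[volume] φ
  snd : w.snd =ᵐ[volume] fun x => ∇ φ x

lemma IsPair.mem {w : PairSpace N p} (h : IsPair Ω w φ) : w ∈ testPairs N p Ω :=
  ⟨φ, h.test.smooth, h.test.compact, h.test.supp, h.fst, h.snd⟩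

lemma IsPair.mem_closure {w : PairSpace N p} (h : IsPair Ω w φ) : w ∈ TestClosure N p Ω :=
  (testPairs N p Ω).le_topologicalClosure h.mem

lemma exists_isPair_of_mem {w : PairSpace N p} (h : w ∈ testPairs N p Ω) :
    ∃ φ, IsPair Ω w φ := by
  obtain ⟨φ, h1, h2, h3, h4, h5⟩ := h
  exact ⟨φ, ⟨h1, h2, h3⟩, h4, h5⟩

lemma IsTest.exists_isPair (h : IsTest Ω φ) (p : ℝ≥0∞) [Fact (1 ≤ p)] :
    ∃ w : TestClosure N p Ω, IsPair Ω w.1 φ := by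
  have key : IsPair Ω (WithLp.toLp 2 ((h.memLp p).toLp φ,
      (h.memLp_gradient 2).toLp fun x => ∇ φ x) : PairSpace N p) φ :=
    ⟨h, (h.memLp p).coeFn_toLp, (h.memLp_gradient 2).coeFn_toLp⟩
  exact ⟨⟨_, key.mem_closure⟩, key⟩

lemma exists_seq_isPair (w : TestClosure N p Ω) :
    ∃ (φ : ℕ → Euc N → ℝ) (v : ℕ → TestClosure N p Ω), (∀ n, IsPair Ω (v n).1 (φ n)) ∧
      Tendsto v atTop (𝓝 w) := by
  obtain ⟨v, hv, hlim⟩ := mem_closure_iff_seq_limit.1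
    (show w.1 ∈ closure (testPairs N p Ω : Set (PairSpace N p)) from w.2)
  choose φ hφ using fun n => exists_isPair_of_mem (hv n)
  exact ⟨φ, fun n => ⟨v n, (hφ n).mem_closure⟩, hφ, tendsto_subtype_rng.2 hlim⟩

/-- A closed property of the elements of the closure holds if it holds for test functions. -/
lemma closure_induction {P : TestClosure N p Ω → Prop} (hP : IsClosed {w | P w})
    (h : ∀ w φ, IsPair Ω w.1 φ → P w) (w : TestClosure N p Ω) : P w := by
  obtain ⟨φ, v, hv, hlim⟩ := exists_seq_isPair w
  exact hP.mem_of_tendsto hlim (Eventually.of_forall fun n => h _ _ (hv n))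

variable (N p Ω) in
/-- The function of a pair. -/
def fstCLM : TestClosure N p Ω →L[ℝ] Lp ℝ p (volume : Measure (Euc N)) :=
  (WithLp.fstL 2 ℝ _ _).comp (TestClosure N p Ω).subtypeL

variable (N p Ω) in
/-- The gradient of a pair. -/
def sndCLM : TestClosure N p Ω →L[ℝ] Lp (Euc N) 2 (volume : Measure (Euc N)) :=
  (WithLp.sndL 2 ℝ _ _).comp (TestClosure N p Ω).subtypeL

@[simp] lemma fstCLM_apply (w : TestClosure N p Ω) : fstCLM N Ω p w = w.1.fst := rfl
@[simp] lemma sndCLM_apply (w : TestClosure N p Ω) : sndCLM N Ω p w = w.1.snd := rfl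

/-- A weighted inequality for test functions extends to the closure. -/
lemma eLpNorm_mul_fst_le {q : ℝ≥0∞} {g : Euc N → ℝ} (hg : Measurable g) {C : ℝ}
    (hC : ∀ φ, IsTest Ω φ → eLpNorm (fun x => g x * φ x) q volume ≤
      ENNReal.ofReal C * eLpNorm (fun x => ∇ φ x) 2 volume) (w : TestClosure N p Ω) :
    eLpNorm (fun x => g x * w.1.fst x) q volume ≤
      ENNReal.ofReal C * eLpNorm w.1.snd 2 volume := by
  obtain ⟨φ, v, hv, hlim⟩ := exists_seq_isPair w
  have h1 : Tendsto (fun n => (v n).1.fst) atTop (𝓝 w.1.fst) :=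
    ((fstCLM N Ω p).continuous.tendsto w).comp hlim
  have h2 : Tendsto (fun n => (v n).1.snd) atTop (𝓝 w.1.snd) :=
    ((sndCLM N Ω p).continuous.tendsto w).comp hlim
  obtain ⟨σ, hσ, hae⟩ := (tendstoInMeasure_of_tendsto_Lp h1).exists_seq_tendsto_ae
  have h3 : Tendsto (fun n => eLpNorm (v (σ n)).1.snd 2 volume) atTop
      (𝓝 (eLpNorm w.1.snd 2 volume)) := by
    have := ((continuous_enorm.tendsto _).comp h2).comp hσ.tendsto_atTop
    simpa [Function.comp_def, Lp.enorm_def] using this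
  refine (Lp.eLpNorm_lim_le_liminf_eLpNorm
    (f := fun n x => g x * (v (σ n)).1.fst x) (fun n => ?_) _ ?_).trans ?_
  · exact hg.aestronglyMeasurable.mul (Lp.aestronglyMeasurable _)
  · filter_upwards [hae] with x hx using hx.const_mul _
  · have h4 : Tendsto (fun n => ENNReal.ofReal C * eLpNorm (v (σ n)).1.snd 2 volume) atTop
      (𝓝 (ENNReal.ofReal C * eLpNorm w.1.snd 2 volume)) :=
      ENNReal.Tendsto.const_mul h3 (Or.inr ENNReal.ofReal_ne_top)
    refine (liminf_le_liminf (Eventually.of_forall fun n => ?_)).trans_eq h4.liminf_eq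
    rw [eLpNorm_congr_ae (hv (σ n)).snd]
    refine le_of_eq_of_le (eLpNorm_congr_ae ?_) (hC _ (hv (σ n)).test)
    filter_upwards [(hv (σ n)).fst] with x hx
    rw [hx]

/-- Multiplication by `g`, as a bounded operator into `L^q`. -/
lemma exists_mulCLM {q : ℝ≥0∞} [Fact (1 ≤ q)] {g : Euc N → ℝ} (hg : Measurable g) {C : ℝ}
    (hC : ∀ φ, IsTest Ω φ → eLpNorm (fun x => g x * φ x) q volume ≤
      ENNReal.ofReal C * eLpNorm (fun x => ∇ φ x) 2 volume)
    (p : ℝ≥0∞) [Fact (1 ≤ p)] :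
    ∃ T : TestClosure N p Ω →L[ℝ] Lp ℝ q (volume : Measure (Euc N)),
      (∀ w, T w =ᵐ[volume] fun x => g x * w.1.fst x) ∧ ∀ w, ‖T w‖ ≤ max C 0 * ‖w.1.snd‖ := by
  have hm : ∀ w : TestClosure N p Ω, MemLp (fun x => g x * w.1.fst x) q volume := fun w =>
    ⟨hg.aestronglyMeasurable.mul (Lp.aestronglyMeasurable _),
      (eLpNorm_mul_fst_le hg hC w).trans_lt
        (ENNReal.mul_lt_top ENNReal.ofReal_lt_top (Lp.eLpNorm_lt_top _))⟩
  have hb : ∀ w : TestClosure N p Ω, ‖(hm w).toLp‖ ≤ max C 0 * ‖w.1.snd‖ := by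
    intro w
    rw [Lp.norm_toLp, Lp.norm_def]
    refine (ENNReal.toReal_mono (ENNReal.mul_ne_top ENNReal.ofReal_ne_top
      (Lp.eLpNorm_ne_top _)) (eLpNorm_mul_fst_le hg hC w)).trans_eq ?_
    rw [ENNReal.toReal_mul, ENNReal.toReal_ofReal']
  let T : TestClosure N p Ω →ₗ[ℝ] Lp ℝ q (volume : Measure (Euc N)) :=
    { toFun := fun w => (hm w).toLp
      map_add' := fun w v => by
        rw [← MemLp.toLp_add, MemLp.toLp_eq_toLp_iff]
        filter_upwards [Lp.coeFn_add w.1.fst v.1.fst] with x hx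
        simp only [Pi.add_apply, Submodule.coe_add, WithLp.add_fst] at hx ⊢
        rw [hx]; ring
      map_smul' := fun c w => by
        rw [RingHom.id_apply, ← MemLp.toLp_const_smul, MemLp.toLp_eq_toLp_iff]
        filter_upwards [Lp.coeFn_smul c w.1.fst] with x hx
        simp only [Pi.smul_apply, Submodule.coe_smul, WithLp.smul_fst, smul_eq_mul] at hx ⊢
        rw [hx]; ring }
  refine ⟨T.mkContinuous (max C 0) fun w => (hb w).trans ?_, fun w => (hm w).coeFn_toLp, hb⟩
  exact mul_le_mul_of_nonneg_left (WithLp.norm_snd_le _ _) (le_max_right _ _)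

lemma eq_zero_off {F : Type*} [NormedAddCommGroup F] {q : ℝ≥0∞} [Fact (1 ≤ q)]
    {f : ℕ → Lp F q (volume : Measure (Euc N))} {f₀ : Lp F q (volume : Measure (Euc N))}
    (h : Tendsto f atTop (𝓝 f₀)) (hf : ∀ n, ∀ᵐ x, x ∉ Ω → f n x = 0) :
    ∀ᵐ x, x ∉ Ω → f₀ x = 0 := by
  obtain ⟨σ, -, hae⟩ := (tendstoInMeasure_of_tendsto_Lp h).exists_seq_tendsto_ae
  filter_upwards [hae, ae_all_iff.2 hf] with x hx hx' hxΩ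
  exact tendsto_nhds_unique hx (by simp [hx' _ hxΩ])

lemma IsTest.eq_zero (h : IsTest Ω φ) {x : Euc N} (hx : x ∉ Ω) : φ x = 0 :=
  image_eq_zero_of_notMem_tsupport fun h' => hx (h.supp h')

lemma IsTest.gradient_eq_zero (h : IsTest Ω φ) {x : Euc N} (hx : x ∉ Ω) : ∇ φ x = 0 := by
  have : fderiv ℝ φ x = 0 := by
    by_contra h'
    exact hx (h.supp (support_fderiv_subset ℝ h'))
  simp [gradient, this]

lemma fst_eq_zero_off (w : TestClosure N p Ω) : ∀ᵐ x, x ∉ Ω → w.1.fst x = 0 := by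
  obtain ⟨φ, v, hv, hlim⟩ := exists_seq_isPair w
  refine eq_zero_off (((fstCLM N Ω p).continuous.tendsto w).comp hlim) fun n => ?_
  filter_upwards [(hv n).fst] with x hx hxΩ
  exact hx.trans ((hv n).test.eq_zero hxΩ)

lemma snd_eq_zero_off (w : TestClosure N p Ω) : ∀ᵐ x, x ∉ Ω → w.1.snd x = 0 := by
  obtain ⟨φ, v, hv, hlim⟩ := exists_seq_isPair w
  refine eq_zero_off (((sndCLM N Ω p).continuous.tendsto w).comp hlim) fun n => ?_
  filter_upwards [(hv n).snd] with x hx hxΩ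
  exact hx.trans ((hv n).test.gradient_eq_zero hxΩ)

lemma norm_sq_Lp_two {F : Type*} [NormedAddCommGroup F] [InnerProductSpace ℝ F]
    (f : Lp F 2 (volume : Measure (Euc N))) : ‖f‖ ^ 2 = ∫ x, ‖f x‖ ^ 2 := by
  rw [← real_inner_self_eq_norm_sq, L2.inner_def]
  simp

lemma setIntegral_snd (w : TestClosure N p Ω) :
    ∫ x in Ω, ‖w.1.snd x‖ ^ 2 = ‖w.1.snd‖ ^ 2 := by
  rw [norm_sq_Lp_two]
  refine setIntegral_eq_integral_of_ae_compl_eq_zero ?_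
  filter_upwards [snd_eq_zero_off w] with x hx hxΩ
  simp [hx hxΩ]

lemma IsPair.norm_snd_sq {w : PairSpace N p} (h : IsPair Ω w φ) :
    ‖w.snd‖ ^ 2 = ∫ x, ‖∇ φ x‖ ^ 2 := by
  rw [norm_sq_Lp_two]
  refine integral_congr_ae ?_
  filter_upwards [h.snd] with x hx
  rw [hx]

end

section

lemma three_le (N : ℕ) [hN : Fact (3 ≤ N)] : (3 : ℝ) ≤ N := by exact_mod_cast hN.out

lemma two_lt_twoStar (N : ℕ) [Fact (3 ≤ N)] : 2 < twoStar N := by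
  have := three_le N
  rw [twoStar, lt_div_iff₀ (by linarith)]
  linarith

lemma inv_twoStar (N : ℕ) [Fact (3 ≤ N)] : (twoStar N)⁻¹ = 2⁻¹ - (N : ℝ)⁻¹ := by
  have := three_le N
  have h2 : (N : ℝ) - 2 ≠ 0 := by linarith
  rw [twoStar]
  field_simp

lemma toReal_ofReal_twoStar (N : ℕ) [Fact (3 ≤ N)] :
    (ENNReal.ofReal (twoStar N)).toReal = twoStar N :=
  ENNReal.toReal_ofReal (by linarith [two_lt_twoStar N])

/-- Sobolev's inequality. -/
lemma exists_sobolev (N : ℕ) [Fact (3 ≤ N)] : ∃ C : ℝ, 0 ≤ C ∧ ∀ φ : Euc N → ℝ, IsTest univ φ →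
    eLpNorm (fun x => 1 * φ x) (ENNReal.ofReal (twoStar N)) volume ≤
      ENNReal.ofReal C * eLpNorm (fun x => ∇ φ x) 2 volume := by
  refine ⟨eLpNormLESNormFDerivOfEqInnerConst (volume : Measure (Euc N)) 2, NNReal.coe_nonneg _,
    fun φ hφ => ?_⟩
  have h3 := three_le N
  have := eLpNorm_le_eLpNorm_fderiv_of_eq_inner (volume : Measure (Euc N)) (u := φ)
    (hφ.smooth.of_le (by simp)) hφ.compact (p := 2) (p' := (twoStar N).toNNReal) (by simp)
    (by simp; have : Fact (3 ≤ N) := inferInstance; have := this.out; omega)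
    (by rw [Real.coe_toNNReal _ (by linarith [two_lt_twoStar N]), inv_twoStar]; simp)
  simp only [one_mul, ENNReal.ofReal_coe_nnreal]
  refine this.trans_eq ?_
  congr 1
  exact eLpNorm_congr_norm_ae (Eventually.of_forall fun x => (norm_gradient φ x).symm)

lemma eLpNorm_two_sq {α F : Type*} [MeasurableSpace α] [NormedAddCommGroup F] (μ : Measure α)
    (f : α → F) : eLpNorm f 2 μ ^ 2 = ∫⁻ x, ‖f x‖ₑ ^ 2 ∂μ := by
  have := eLpNorm_nnreal_pow_eq_lintegral (μ := μ) (f := f) (p := 2) (by simp)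
  simpa using this

lemma lintegral_mul_sq_le {α : Type*} [MeasurableSpace α] {μ : Measure α} {f g : α → ℝ≥0∞}
    (hf : AEMeasurable f μ) (hg : AEMeasurable g μ) :
    (∫⁻ x, f x * g x ∂μ) ^ 2 ≤ (∫⁻ x, f x ^ 2 ∂μ) * ∫⁻ x, g x ^ 2 ∂μ := by
  have h := ENNReal.lintegral_mul_le_Lp_mul_Lq μ Real.HolderConjugate.two_two hf hg
  have h' := pow_le_pow_left' h 2
  simp only [Pi.mul_apply, ENNReal.rpow_two, mul_pow] at h'
  refine h'.trans_eq ?_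
  simp only [← ENNReal.rpow_natCast, ← ENNReal.rpow_mul]
  norm_num

lemma lintegral_comp_smul_Euc {N : ℕ} (f : Euc N → ℝ≥0∞) (hf : Measurable f) {t : ℝ}
    (ht : 0 < t) : ∫⁻ x, f (t • x) = ENNReal.ofReal ((t ^ N)⁻¹) * ∫⁻ x, f x := by
  have := lintegral_map (μ := (volume : Measure (Euc N))) hf (measurable_const_smul t)
  rw [← this, Measure.map_addHaar_smul _ ht.ne', lintegral_smul_measure]
  simp [abs_of_pos ht]

lemma enorm_fderiv_apply_le {N : ℕ} (φ : Euc N → ℝ) (z y : Euc N) :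
    ‖fderiv ℝ φ z y‖ₑ ≤ ‖y‖ₑ * ‖∇ φ z‖ₑ := by
  have h : ‖∇ φ z‖ₑ = ‖fderiv ℝ φ z‖ₑ := by
    rw [← ofReal_norm, norm_gradient, ofReal_norm]
  rw [h, mul_comm]
  exact (fderiv ℝ φ z).le_opENorm y

lemma enorm_le_lintegral_ray {N : ℕ} {φ : Euc N → ℝ} (hφ : IsTest univ φ) {x : Euc N}
    (hx : x ≠ 0) : ‖φ x‖ₑ ≤ ‖x‖ₑ * ∫⁻ t in Ioi (1 : ℝ), ‖∇ φ (t • x)‖ₑ := by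
  obtain ⟨R, hR⟩ := hφ.compact.isCompact.isBounded.subset_ball 0
  have hx' : 0 < ‖x‖ := norm_pos_iff.2 hx
  set T : ℝ := max 1 (R / ‖x‖) with hT
  have h1T : 1 ≤ T := le_max_left _ _
  have hφT : φ (T • x) = 0 := by
    refine image_eq_zero_of_notMem_tsupport fun h => ?_
    have := hR h
    rw [mem_ball_zero_iff, norm_smul, Real.norm_of_nonneg (by linarith)] at this
    have h2 : R / ‖x‖ * ‖x‖ ≤ T * ‖x‖ := by gcongr; exact le_max_right _ _
    rw [div_mul_cancel₀ _ hx'.ne'] at h2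
    linarith
  have hd : ∀ t : ℝ, HasDerivAt (fun t : ℝ => φ (t • x)) (fderiv ℝ φ (t • x) x) t := by
    intro t
    have h1 : HasDerivAt (fun t : ℝ => t • x) x t := by
      simpa using (hasDerivAt_id t).smul_const x
    exact (hφ.differentiable _).hasFDerivAt.comp_hasDerivAt t h1
  have hc : Continuous fun t : ℝ => fderiv ℝ φ (t • x) x :=
    ((hφ.smooth.continuous_fderiv (by simp)).comp (by fun_prop)).clm_apply continuous_const
  have hint := intervalIntegral.integral_eq_sub_of_hasDerivAt (a := 1) (b := T)
    (fun t _ => hd t) (hc.intervalIntegrable _ _)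
  rw [hφT, one_smul, zero_sub] at hint
  calc ‖φ x‖ₑ = ‖∫ t in (1 : ℝ)..T, fderiv ℝ φ (t • x) x‖ₑ := by rw [hint, enorm_neg]
    _ ≤ ∫⁻ t in Ioc 1 T, ‖fderiv ℝ φ (t • x) x‖ₑ := by
      rw [intervalIntegral.integral_of_le h1T]
      exact enorm_integral_le_lintegral_enorm _
    _ ≤ ∫⁻ t in Ioi (1 : ℝ), ‖x‖ₑ * ‖∇ φ (t • x)‖ₑ := by
      refine (lintegral_mono fun t => ?_).trans (lintegral_mono_set Ioc_subset_Ioi_self)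
      exact enorm_fderiv_apply_le _ _ _
    _ = _ := by
      rw [lintegral_const_mul' _ _ (by simp)]

/-- Hardy's inequality. -/
lemma exists_hardy (N : ℕ) [Fact (3 ≤ N)] : ∃ C : ℝ, 0 ≤ C ∧ ∀ φ : Euc N → ℝ, IsTest univ φ →
    eLpNorm (fun x => ‖x‖⁻¹ * φ x) 2 volume ≤
      ENNReal.ofReal C * eLpNorm (fun x => ∇ φ x) 2 volume := by
  set K : ℝ≥0∞ := ∫⁻ t in Ioi (1 : ℝ), ENNReal.ofReal (t ^ (-3 / 2 : ℝ)) with hK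
  have hKt : K ≠ ⊤ := by
    have := integrableOn_Ioi_rpow_of_lt (a := (-3 / 2 : ℝ)) (by norm_num) (c := 1) one_pos
    refine ((lintegral_mono fun t => ?_).trans_lt this.2).ne
    exact Real.ofReal_le_enorm _
  refine ⟨K.toReal, ENNReal.toReal_nonneg, fun φ hφ => ?_⟩
  rw [ENNReal.ofReal_toReal hKt]
  have hgm : Measurable fun x => ‖∇ φ x‖ₑ := hφ.continuous_gradient.enorm.measurable
  have hg2 : Measurable fun z : Euc N × ℝ => ‖∇ φ (z.2 • z.1)‖ₑ :=
    (hφ.continuous_gradient.comp (by fun_prop : Continuous fun z : Euc N × ℝ => z.2 • z.1)).enorm.measurable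
  have hw1 : Measurable fun t : ℝ => ENNReal.ofReal (t ^ (-3 / 4 : ℝ)) := by fun_prop
  have hw2 : Measurable fun t : ℝ => ENNReal.ofReal (t ^ (3 / 4 : ℝ)) := by fun_prop
  have hpt : ∀ x : Euc N, ‖‖x‖⁻¹ * φ x‖ₑ ^ 2 ≤
      K * ∫⁻ t in Ioi (1 : ℝ), (ENNReal.ofReal (t ^ (3 / 4 : ℝ)) * ‖∇ φ (t • x)‖ₑ) ^ 2 := by
    intro x
    rcases eq_or_ne x 0 with rfl | hx
    · simp
    have h1 : ‖‖x‖⁻¹ * φ x‖ₑ ≤ ∫⁻ t in Ioi (1 : ℝ), ‖∇ φ (t • x)‖ₑ := by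
      have h0 : ‖x‖ₑ ≠ 0 := by simpa using hx
      rw [enorm_mul, enorm_inv (by simpa using hx), enorm_norm]
      calc _ ≤ ‖x‖ₑ⁻¹ * (‖x‖ₑ * ∫⁻ t in Ioi (1 : ℝ), ‖∇ φ (t • x)‖ₑ) := by
            gcongr; exact enorm_le_lintegral_ray hφ hx
        _ = _ := by rw [← mul_assoc, ENNReal.inv_mul_cancel h0 (by simp), one_mul]
    have h2 : ∫⁻ t in Ioi (1 : ℝ), ‖∇ φ (t • x)‖ₑ = ∫⁻ t in Ioi (1 : ℝ),
        ENNReal.ofReal (t ^ (-3 / 4 : ℝ)) * (ENNReal.ofReal (t ^ (3 / 4 : ℝ)) * ‖∇ φ (t • x)‖ₑ) := by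
      refine setLIntegral_congr_fun measurableSet_Ioi fun t ht => ?_
      have ht0 : (0 : ℝ) < t := one_pos.trans ht
      rw [← mul_assoc, ← ENNReal.ofReal_mul (by positivity), ← Real.rpow_add ht0]
      norm_num
    refine (pow_le_pow_left' (h1.trans_eq h2) 2).trans
      ((lintegral_mul_sq_le (by fun_prop) ?_).trans_eq ?_)
    · exact (hw2.mul (hg2.comp (measurable_const.prodMk measurable_id))).aemeasurable
    · congr 1
      refine setLIntegral_congr_fun measurableSet_Ioi fun t ht => ?_
      have ht0 : (0 : ℝ) < t := one_pos.trans ht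
      rw [← ENNReal.ofReal_pow (by positivity), ← Real.rpow_natCast, ← Real.rpow_mul ht0.le]
      norm_num
  rw [← ENNReal.pow_le_pow_left_iff (n := 2) two_ne_zero, mul_pow, eLpNorm_two_sq, eLpNorm_two_sq]
  calc _ ≤ ∫⁻ x, K * ∫⁻ t in Ioi (1 : ℝ),
        (ENNReal.ofReal (t ^ (3 / 4 : ℝ)) * ‖∇ φ (t • x)‖ₑ) ^ 2 := lintegral_mono hpt
    _ = K * ∫⁻ t in Ioi (1 : ℝ), ∫⁻ x,
        (ENNReal.ofReal (t ^ (3 / 4 : ℝ)) * ‖∇ φ (t • x)‖ₑ) ^ 2 := by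
      rw [lintegral_const_mul' _ _ hKt, lintegral_lintegral_swap]
      exact (((hw2.comp measurable_snd).mul hg2).pow_const 2).aemeasurable
    _ ≤ K * ∫⁻ t in Ioi (1 : ℝ), ENNReal.ofReal (t ^ (-3 / 2 : ℝ)) * ∫⁻ x, ‖∇ φ x‖ₑ ^ 2 := by
      gcongr K * ?_
      refine setLIntegral_mono' measurableSet_Ioi fun t ht => ?_
      have ht1 : (1 : ℝ) < t := ht
      have ht0 : (0 : ℝ) < t := one_pos.trans ht
      simp_rw [mul_pow]
      rw [lintegral_const_mul' _ _ (by finiteness),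
        lintegral_comp_smul_Euc (fun x => ‖∇ φ x‖ₑ ^ 2) (hgm.pow_const 2) ht0, ← mul_assoc,
        ← ENNReal.ofReal_pow (by positivity), ← ENNReal.ofReal_mul (by positivity)]
      gcongr
      rw [← Real.rpow_natCast, ← Real.rpow_mul ht0.le, ← Real.rpow_natCast, ← Real.rpow_neg ht0.le,
        ← Real.rpow_add ht0]
      refine Real.rpow_le_rpow_of_exponent_le ht1.le ?_
      have := three_le N
      push_cast
      linarith
    _ = K ^ 2 * ∫⁻ x, ‖∇ φ x‖ₑ ^ 2 := by
      rw [lintegral_mul_const _ (by fun_prop), ← hK]; ring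

/-- The `L^2` modulus of continuity of a test function. -/
lemma lintegral_translate_sub_le {N : ℕ} {φ : Euc N → ℝ} (hφ : IsTest univ φ) (y : Euc N) :
    ∫⁻ x, ‖φ (x + y) - φ x‖ₑ ^ 2 ≤ ‖y‖ₑ ^ 2 * ∫⁻ x, ‖∇ φ x‖ₑ ^ 2 := by
  have hgm : Measurable fun z : Euc N × ℝ => ‖∇ φ (z.1 + z.2 • y)‖ₑ :=
    (hφ.continuous_gradient.comp
      (by fun_prop : Continuous fun z : Euc N × ℝ => z.1 + z.2 • y)).enorm.measurable
  have hpt : ∀ x, ‖φ (x + y) - φ x‖ₑ ^ 2 ≤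
      ‖y‖ₑ ^ 2 * ∫⁻ t in Ioc (0 : ℝ) 1, ‖∇ φ (x + t • y)‖ₑ ^ 2 := by
    intro x
    have hd : ∀ t : ℝ, HasDerivAt (fun t : ℝ => φ (x + t • y)) (fderiv ℝ φ (x + t • y) y) t := by
      intro t
      have h1 : HasDerivAt (fun t : ℝ => x + t • y) y t := by
        simpa using ((hasDerivAt_id t).smul_const y).const_add x
      exact (hφ.differentiable _).hasFDerivAt.comp_hasDerivAt t h1
    have hc : Continuous fun t : ℝ => fderiv ℝ φ (x + t • y) y :=
      ((hφ.smooth.continuous_fderiv (by simp)).comp (by fun_prop)).clm_apply continuous_const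
    have hint := intervalIntegral.integral_eq_sub_of_hasDerivAt (a := 0) (b := 1)
      (fun t _ => hd t) (hc.intervalIntegrable _ _)
    simp only [one_smul, zero_smul, add_zero] at hint
    have h1 : ‖φ (x + y) - φ x‖ₑ ≤ ∫⁻ t in Ioc (0 : ℝ) 1, ‖y‖ₑ * ‖∇ φ (x + t • y)‖ₑ := by
      rw [← hint, intervalIntegral.integral_of_le zero_le_one]
      refine (enorm_integral_le_lintegral_enorm _).trans (lintegral_mono fun t => ?_)
      exact enorm_fderiv_apply_le _ _ _
    rw [lintegral_const_mul' _ _ (by simp)] at h1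
    refine (pow_le_pow_left' h1 2).trans ?_
    rw [mul_pow]
    gcongr
    have := lintegral_mul_sq_le (μ := volume.restrict (Ioc (0 : ℝ) 1)) (f := fun _ => 1)
      (g := fun t => ‖∇ φ (x + t • y)‖ₑ) aemeasurable_const
      (hgm.comp (measurable_const.prodMk measurable_id)).aemeasurable
    simpa using this
  calc _ ≤ ∫⁻ x, ‖y‖ₑ ^ 2 * ∫⁻ t in Ioc (0 : ℝ) 1, ‖∇ φ (x + t • y)‖ₑ ^ 2 := lintegral_mono hpt
    _ = ‖y‖ₑ ^ 2 * ∫⁻ t in Ioc (0 : ℝ) 1, ∫⁻ x, ‖∇ φ (x + t • y)‖ₑ ^ 2 := by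
      rw [lintegral_const_mul' _ _ (by finiteness), lintegral_lintegral_swap]
      exact (hgm.pow_const 2).aemeasurable
    _ = _ := by
      simp_rw [lintegral_add_right_eq_self (fun x => ‖∇ φ x‖ₑ ^ 2)]
      simp

end

section

/-- A homogeneous function of degree `p` which is `o(|b|^r)` at `(±1, 0)`. -/
lemma homogeneous_bound {p r : ℝ} {F : ℝ → ℝ → ℝ}
    (hF : Continuous (Function.uncurry F))
    (hom : ∀ t a b, 0 < t → F (t * a) (t * b) = t ^ p * F a b) (hp : 0 < p)
    (h : ∀ s : ℝ, |s| = 1 → ∀ ε > 0, ∀ᶠ b in 𝓝 (0 : ℝ), |F s b| ≤ ε * |b| ^ r) {ε : ℝ}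
    (hε : 0 < ε) :
    ∃ C, 0 ≤ C ∧ ∀ a b, |F a b| ≤ ε * (|a| ^ (p - r) * |b| ^ r) + C * |b| ^ p := by
  have h' := (h 1 (by simp) ε hε).and (h (-1) (by simp) ε hε)
  obtain ⟨δ, hδ, hball⟩ := Metric.eventually_nhds_iff.1 h'
  obtain ⟨C, hC⟩ := ((isCompact_Icc (a := -(2 / δ)) (b := 2 / δ)).prod
    (isCompact_Icc (a := (-1 : ℝ)) (b := 1))).exists_bound_of_continuousOn hF.continuousOn
  have hC0 : 0 ≤ C := (norm_nonneg _).trans (hC (0, 0) ⟨⟨by simp; positivity, by positivity⟩,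
    by norm_num, by norm_num⟩)
  refine ⟨C, hC0, fun a b => ?_⟩
  by_cases hab : |b| ≤ δ / 2 * |a|
  · rcases eq_or_ne a 0 with rfl | ha
    · have hb : b = 0 := by simpa using hab
      have := hom 2 0 0 two_pos
      simp only [mul_zero] at this
      have h2 : (1 : ℝ) < 2 ^ p := Real.one_lt_rpow one_lt_two hp
      have h0 : F 0 0 = 0 := by nlinarith
      rw [hb, h0]
      simp only [abs_zero]
      positivity
    · have ha' : 0 < |a| := abs_pos.2 ha
      have e := hom |a| (a / |a|) (b / |a|) ha'
      rw [mul_div_cancel₀ _ ha'.ne', mul_div_cancel₀ _ ha'.ne'] at e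
      have hs : |F (a / |a|) (b / |a|)| ≤ ε * |b / (|a|)| ^ r := by
        have hb := hball (y := b / |a|) (by
          rw [dist_zero_right, Real.norm_eq_abs, abs_div, abs_abs]
          calc |b| / |a| ≤ δ / 2 := by rwa [div_le_iff₀ ha']
            _ < δ := by linarith)
        rcases abs_cases a with ⟨h1, -⟩ | ⟨h1, -⟩
        · have : a / |a| = 1 := by rw [h1]; exact div_self ha
          rw [this]; exact hb.1
        · have : a / |a| = -1 := by rw [h1, div_neg, div_self ha]
          rw [this]; exact hb.2
      have : |F a b| ≤ ε * (|a| ^ (p - r) * |b| ^ r) := by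
        rw [e, abs_mul, abs_of_nonneg (by positivity : 0 ≤ |a| ^ p)]
        calc |a| ^ p * |F (a / |a|) (b / |a|)| ≤ |a| ^ p * (ε * |b / (|a|)| ^ r) := by gcongr
          _ = _ := by
            rw [abs_div, abs_abs, Real.div_rpow (abs_nonneg _) (abs_nonneg _), Real.rpow_sub ha']
            field_simp
      have h3 : 0 ≤ C * |b| ^ p := by positivity
      linarith
  · push Not at hab
    have hb' : 0 < |b| := lt_of_le_of_lt (by positivity) hab
    have e := hom |b| (a / |b|) (b / |b|) hb'
    rw [mul_div_cancel₀ _ hb'.ne', mul_div_cancel₀ _ hb'.ne'] at e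
    have h1 : |a / (|b|)| ≤ 2 / δ := by
      rw [abs_div, abs_abs, div_le_div_iff₀ hb' hδ]
      nlinarith
    have h2 : |b / (|b|)| ≤ 1 := by
      rw [abs_div, abs_abs, div_self hb'.ne']
    have h3 : |F (a / |b|) (b / |b|)| ≤ C := hC (a / |b|, b / |b|) ⟨abs_le.1 h1, abs_le.1 h2⟩
    have h4 : |F a b| ≤ C * |b| ^ p := by
      rw [e, abs_mul, abs_of_nonneg (by positivity : 0 ≤ |b| ^ p), mul_comm]
      gcongr
    have : 0 ≤ ε * (|a| ^ (p - r) * |b| ^ r) := by positivity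
    linarith

variable {p : ℝ}

lemma continuous_abs_rpow_mul (hp : 2 < p) : Continuous fun a : ℝ => |a| ^ (p - 2) * a :=
  (continuous_abs.rpow_const fun _ => Or.inr (by linarith)).mul continuous_id

lemma abs_rpow_mul_self (hp : 2 < p) (a : ℝ) : |a| ^ (p - 2) * a * a = |a| ^ p := by
  rcases eq_or_ne a 0 with rfl | ha
  · simp [Real.zero_rpow (by linarith : p ≠ 0)]
  rw [mul_assoc, ← sq, ← sq_abs, ← Real.rpow_natCast, ← Real.rpow_add (abs_pos.2 ha)]
  norm_num

lemma abs_rpow_mul (hp : 2 < p) (a : ℝ) : |(|a| ^ (p - 2) * a)| = |a| ^ (p - 1) := by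
  rcases eq_or_ne a 0 with rfl | ha
  · simp [Real.zero_rpow (by linarith : p - 1 ≠ 0)]
  rw [abs_mul, abs_of_nonneg (by positivity : 0 ≤ |a| ^ (p - 2))]
  conv_lhs => rw [← Real.rpow_one |a|, ← Real.rpow_mul (abs_nonneg a)]
  rw [← Real.rpow_add (abs_pos.2 ha)]
  congr 1
  ring

lemma hom_abs_rpow {t : ℝ} (ht : 0 < t) (a : ℝ) : |t * a| ^ p = t ^ p * |a| ^ p := by
  rw [abs_mul, abs_of_pos ht, Real.mul_rpow ht.le (abs_nonneg _)]

/-- The elementary inequality behind the Brezis-Lieb lemma. -/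
lemma abs_add_rpow_sub_bound (hp : 2 < p) {ε : ℝ} (hε : 0 < ε) :
    ∃ C, 0 ≤ C ∧ ∀ a b : ℝ, |(|a + b| ^ p - |a| ^ p - |b| ^ p)| ≤ ε * |a| ^ p + C * |b| ^ p := by
  have hc : Continuous fun a : ℝ => |a| ^ p :=
    continuous_abs.rpow_const fun _ => Or.inr (by linarith)
  have hcF : Continuous (Function.uncurry fun a b : ℝ => |a + b| ^ p - |a| ^ p - |b| ^ p) :=
    ((hc.comp (continuous_fst.add continuous_snd)).sub (hc.comp continuous_fst)).sub
      (hc.comp continuous_snd)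
  have := homogeneous_bound (p := p) (r := 0) hcF
    (fun t a b ht => by simp only [← mul_add, hom_abs_rpow ht]; ring) (by linarith) (fun s hs ε hε => ?_) hε
  · simpa using this
  · have h0 : Tendsto (fun b : ℝ => |(|s + b| ^ p - |s| ^ p - |b| ^ p)|) (𝓝 0) (𝓝 0) := by
      have h1 : Continuous fun b : ℝ => |(|s + b| ^ p - |s| ^ p - |b| ^ p)| :=
        (hcF.comp (Continuous.prodMk_right s)).abs
      have := h1.tendsto 0
      simpa [Real.zero_rpow (by linarith : p ≠ 0)] using this
    filter_upwards [h0.eventually (ge_mem_nhds hε)] with b hb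
    simpa using hb

lemma abs_add_rpow_mul_bound (hp : 2 < p) {ε : ℝ} (hε : 0 < ε) :
    ∃ C, 0 ≤ C ∧ ∀ a b : ℝ,
      |(|a + b| ^ (p - 2) * (a + b) * a - |a| ^ p)| ≤ ε * |a| ^ p + C * |b| ^ p := by
  have hc : Continuous fun a : ℝ => |a| ^ p :=
    continuous_abs.rpow_const fun _ => Or.inr (by linarith)
  have hcF : Continuous (Function.uncurry fun a b : ℝ =>
      |a + b| ^ (p - 2) * (a + b) * a - |a| ^ p) :=
    (((continuous_abs_rpow_mul hp).comp (continuous_fst.add continuous_snd)).mul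
      continuous_fst).sub (hc.comp continuous_fst)
  have := homogeneous_bound (p := p) (r := 0) hcF
    (fun t a b ht => ?_) (by linarith) (fun s hs ε hε => ?_) hε
  · simpa using this
  · simp only [← mul_add, hom_abs_rpow ht]
    have : t ^ p = t ^ (p - 2) * t * t := by
      have := abs_rpow_mul_self hp t
      rwa [abs_of_pos ht, eq_comm] at this
    rw [this]; ring
  · have h0 : Tendsto (fun b : ℝ => |(|s + b| ^ (p - 2) * (s + b) * s - |s| ^ p)|) (𝓝 0) (𝓝 0) := by
      have h1 : Continuous fun b : ℝ => |(|s + b| ^ (p - 2) * (s + b) * s - |s| ^ p)| :=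
        (hcF.comp (Continuous.prodMk_right s)).abs
      have := h1.tendsto 0
      simpa [abs_rpow_mul_self hp] using this
    filter_upwards [h0.eventually (ge_mem_nhds hε)] with b hb
    simpa using hb

lemma abs_add_rpow_taylor_bound (hp : 2 < p) {ε : ℝ} (hε : 0 < ε) :
    ∃ C, 0 ≤ C ∧ ∀ a b : ℝ, |(|a + b| ^ p - |a| ^ p - p * (|a| ^ (p - 2) * a) * b)| ≤
      ε * (|a| ^ (p - 1) * |b|) + C * |b| ^ p := by
  have hc : Continuous fun a : ℝ => |a| ^ p :=
    continuous_abs.rpow_const fun _ => Or.inr (by linarith)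
  have hcF : Continuous (Function.uncurry fun a b : ℝ =>
      |a + b| ^ p - |a| ^ p - p * (|a| ^ (p - 2) * a) * b) :=
    ((hc.comp (continuous_fst.add continuous_snd)).sub (hc.comp continuous_fst)).sub
      ((continuous_const.mul ((continuous_abs_rpow_mul hp).comp continuous_fst)).mul continuous_snd)
  have := homogeneous_bound (p := p) (r := 1) hcF
    (fun t a b ht => ?_) (by linarith) (fun s hs ε hε => ?_) hε
  · simpa using this
  · simp only [← mul_add, hom_abs_rpow ht]
    have : t ^ p = t ^ (p - 2) * t * t := by
      have := abs_rpow_mul_self hp t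
      rwa [abs_of_pos ht, eq_comm] at this
    rw [this]; ring
  · have hd := (hasDerivAt_abs_rpow s (by linarith : 1 < p))
    have := (hasDerivAt_iff_isLittleO_nhds_zero.1 hd).def hε
    filter_upwards [this] with b hb
    simpa [mul_comm, mul_left_comm, mul_assoc] using hb

/-- A dominated convergence theorem with a domination up to `ε` times a bounded sequence. -/
lemma tendsto_integral_of_eps_dominated {α : Type*} [MeasurableSpace α] {μ : Measure α}
    {f g : ℕ → α → ℝ} {G : α → ℝ} {M : ℝ} (hf : ∀ n, AEStronglyMeasurable (f n) μ)
    (hg : ∀ n, Integrable (g n) μ) (hg0 : ∀ n x, 0 ≤ g n x) (hM : ∀ n, ∫ x, g n x ∂μ ≤ M)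
    (hG : Integrable G μ) (hG0 : ∀ x, 0 ≤ G x)
    (hb : ∀ ε > 0, ∃ C, 0 ≤ C ∧ ∀ n, ∀ᵐ x ∂μ, |f n x| ≤ ε * g n x + C * G x)
    (hlim : ∀ᵐ x ∂μ, Tendsto (fun n => f n x) atTop (𝓝 0)) :
    Tendsto (fun n => ∫ x, f n x ∂μ) atTop (𝓝 0) := by
  have hM0 : 0 ≤ M := (integral_nonneg (hg0 0)).trans (hM 0)
  rw [Metric.tendsto_atTop']
  intro ε hε
  set η : ℝ := ε / (2 * (M + 1)) with hη
  have hη0 : 0 < η := by positivity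
  obtain ⟨C, hC0, hC⟩ := hb η hη0
  have hmeas : ∀ n, AEStronglyMeasurable (fun x => max (|f n x| - η * g n x) 0) μ := fun n =>
    (((hf n).norm).sub ((hg n).1.const_mul η)).sup aestronglyMeasurable_const
  have hbd : ∀ n, ∀ᵐ x ∂μ, ‖max (|f n x| - η * g n x) 0‖ ≤ C * G x := by
    intro n
    filter_upwards [hC n] with x hx
    rw [Real.norm_of_nonneg (le_max_right _ _)]
    exact max_le (by linarith) (mul_nonneg hC0 (hG0 x))
  have hDCT : Tendsto (fun n => ∫ x, max (|f n x| - η * g n x) 0 ∂μ) atTop (𝓝 (∫ _, (0 : ℝ) ∂μ)) := by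
    refine tendsto_integral_of_dominated_convergence (fun x => C * G x) hmeas (hG.const_mul C) hbd ?_
    filter_upwards [hlim] with x hx
    have h0 : Tendsto (fun n => |f n x|) atTop (𝓝 0) := by simpa using hx.abs
    refine squeeze_zero (fun n => le_max_right _ _) (fun n => ?_) h0
    exact max_le (by have := mul_nonneg hη0.le (hg0 n x); linarith) (abs_nonneg _)
  rw [integral_zero] at hDCT
  obtain ⟨n₀, hn₀⟩ := (Metric.tendsto_atTop'.1 hDCT) (ε / 2) (by positivity)
  refine ⟨n₀, fun n hn => ?_⟩
  have h1 := hn₀ n hn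
  rw [dist_zero_right, Real.norm_eq_abs] at h1 ⊢
  have hint : Integrable (fun x => max (|f n x| - η * g n x) 0) μ :=
    (hG.const_mul C).mono' (hmeas n) (hbd n)
  calc |∫ x, f n x ∂μ| ≤ ∫ x, |f n x| ∂μ := abs_integral_le_integral_abs
    _ ≤ ∫ x, (max (|f n x| - η * g n x) 0 + η * g n x) ∂μ := by
      refine integral_mono_of_nonneg (Eventually.of_forall fun x => abs_nonneg _)
        (hint.add ((hg n).const_mul η)) (Eventually.of_forall fun x => ?_)
      have := le_max_left (|f n x| - η * g n x) 0
      simp only; linarith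
    _ = ∫ x, max (|f n x| - η * g n x) 0 ∂μ + η * ∫ x, g n x ∂μ := by
      rw [integral_add hint ((hg n).const_mul η), integral_const_mul]
    _ < ε / 2 + ε / 2 := by
      refine add_lt_add_of_lt_of_le (lt_of_abs_lt h1) ?_
      calc η * ∫ x, g n x ∂μ ≤ η * (M + 1) := by gcongr; linarith [hM n]
        _ = ε / 2 := by rw [hη]; field_simp
    _ = ε := by ring

section Lp

variable {α : Type*} [MeasurableSpace α] {μ : Measure α}

lemma integrable_abs_rpow (hp : 2 < p) (u : Lp ℝ (ENNReal.ofReal p) μ) :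
    Integrable (fun x => |u x| ^ p) μ := by
  have := (Lp.memLp u).integrable_norm_rpow (by simp; linarith) ENNReal.ofReal_ne_top
  rwa [ENNReal.toReal_ofReal (by linarith)] at this

lemma integral_abs_rpow_eq (hp : 2 < p) (u : Lp ℝ (ENNReal.ofReal p) μ) :
    ∫ x, |u x| ^ p ∂μ = ‖u‖ ^ p := by
  have h0 : 0 ≤ ∫ x, |u x| ^ p ∂μ := integral_nonneg fun x => by positivity
  rw [Lp.norm_def, (Lp.memLp u).eLpNorm_eq_integral_rpow_norm (by simp; linarith)
    ENNReal.ofReal_ne_top, ENNReal.toReal_ofReal (by positivity),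
    ENNReal.toReal_ofReal (by linarith)]
  simp only [Real.norm_eq_abs]
  rw [← Real.rpow_mul h0, inv_mul_cancel₀ (by linarith), Real.rpow_one]

lemma memLp_abs_rpow_sub_one (hp : 2 < p) (u : Lp ℝ (ENNReal.ofReal p) μ) :
    MemLp (fun x => |u x| ^ (p - 1)) (ENNReal.ofReal (p / (p - 1))) μ := by
  have hq : 0 < p / (p - 1) := div_pos (by linarith) (by linarith)
  rw [← integrable_norm_rpow_iff _ (by simpa using hq) ENNReal.ofReal_ne_top,
    ENNReal.toReal_ofReal hq.le]
  · refine (integrable_abs_rpow hp u).congr (Eventually.of_forall fun x => ?_)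
    simp only
    rw [Real.norm_of_nonneg (by positivity), ← Real.rpow_mul (abs_nonneg _),
      mul_div_cancel₀ _ (by linarith)]
  · exact ((continuous_abs.rpow_const fun _ => Or.inr (by linarith)).comp_aestronglyMeasurable
      (Lp.aestronglyMeasurable u))

lemma holderConjugate_sub_one (hp : 2 < p) : Real.HolderConjugate (p / (p - 1)) p :=
  (Real.HolderConjugate.conjExponent (by linarith : 1 < p)).symm

lemma integrable_abs_rpow_sub_one_mul (hp : 2 < p) (u v : Lp ℝ (ENNReal.ofReal p) μ) :
    Integrable (fun x => |u x| ^ (p - 1) * |v x|) μ := by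
  have := (holderConjugate_sub_one hp).ennrealOfReal
  exact (memLp_abs_rpow_sub_one hp u).integrable_mul (Lp.memLp v).abs

lemma integral_abs_rpow_sub_one_mul_le [Fact (1 ≤ ENNReal.ofReal p)] (hp : 2 < p) (u v : Lp ℝ (ENNReal.ofReal p) μ) :
    ∫ x, |u x| ^ (p - 1) * |v x| ∂μ ≤ ‖u‖ ^ (p - 1) * ‖v‖ := by
  have h := integral_mul_le_Lp_mul_Lq_of_nonneg (holderConjugate_sub_one hp)
    (f := fun x => |u x| ^ (p - 1)) (g := fun x => |v x|)
    (Eventually.of_forall fun x => by positivity) (Eventually.of_forall fun x => abs_nonneg _)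
    (memLp_abs_rpow_sub_one hp u) (Lp.memLp v).abs
  refine h.trans_eq ?_
  have e : ∀ x, (|u x| ^ (p - 1)) ^ (p / (p - 1)) = |u x| ^ p := fun x => by
    rw [← Real.rpow_mul (abs_nonneg _), mul_div_cancel₀ _ (by linarith)]
  simp only [e]
  rw [integral_abs_rpow_eq hp, integral_abs_rpow_eq hp, ← Real.rpow_mul (norm_nonneg u),
    ← Real.rpow_mul (norm_nonneg v), mul_one_div_cancel (by linarith), Real.rpow_one]
  congr 2
  field_simp

lemma integrable_abs_rpow_mul_mul (hp : 2 < p) (u v : Lp ℝ (ENNReal.ofReal p) μ) :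
    Integrable (fun x => |u x| ^ (p - 2) * u x * v x) μ := by
  refine (integrable_abs_rpow_sub_one_mul hp u v).mono'
    (((continuous_abs_rpow_mul hp).comp_aestronglyMeasurable (Lp.aestronglyMeasurable u)).mul
      (Lp.aestronglyMeasurable v)) (Eventually.of_forall fun x => ?_)
  rw [norm_mul, Real.norm_eq_abs, Real.norm_eq_abs, abs_rpow_mul hp]

variable [Fact (1 ≤ ENNReal.ofReal p)]

/-- The functional `v ↦ ∫ |u|^{p-2} u v`. -/
lemma exists_powerCLM (hp : 2 < p) (u : Lp ℝ (ENNReal.ofReal p) μ) :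
    ∃ T : Lp ℝ (ENNReal.ofReal p) μ →L[ℝ] ℝ, ∀ v, T v = ∫ x, |u x| ^ (p - 2) * u x * v x ∂μ := by
  let T : Lp ℝ (ENNReal.ofReal p) μ →ₗ[ℝ] ℝ :=
    { toFun := fun v => ∫ x, |u x| ^ (p - 2) * u x * v x ∂μ
      map_add' := fun v w => by
        rw [← integral_add (integrable_abs_rpow_mul_mul hp u v) (integrable_abs_rpow_mul_mul hp u w)]
        refine integral_congr_ae ?_
        filter_upwards [Lp.coeFn_add v w] with x hx
        rw [hx, Pi.add_apply, mul_add]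
      map_smul' := fun c v => by
        rw [RingHom.id_apply, smul_eq_mul, ← integral_const_mul]
        refine integral_congr_ae ?_
        filter_upwards [Lp.coeFn_smul c v] with x hx
        rw [hx, Pi.smul_apply, smul_eq_mul]
        ring }
  refine ⟨T.mkContinuous (‖u‖ ^ (p - 1)) fun v => ?_, fun v => rfl⟩
  refine (norm_integral_le_integral_norm _).trans ((integral_congr_ae ?_).trans_le
    (integral_abs_rpow_sub_one_mul_le hp u v))
  refine Eventually.of_forall fun x => ?_
  simp only
  rw [norm_mul, Real.norm_eq_abs, Real.norm_eq_abs, abs_rpow_mul hp]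

/-- `u ↦ ∫ |u|^p` is Fréchet differentiable on `L^p`. -/
lemma hasFDerivAt_integral_abs_rpow (hp : 2 < p) (u : Lp ℝ (ENNReal.ofReal p) μ)
    {T : Lp ℝ (ENNReal.ofReal p) μ →L[ℝ] ℝ}
    (hT : ∀ v, T v = ∫ x, |u x| ^ (p - 2) * u x * v x ∂μ) :
    HasFDerivAt (fun u : Lp ℝ (ENNReal.ofReal p) μ => ∫ x, |u x| ^ p ∂μ) (p • T) u := by
  rw [hasFDerivAt_iff_isLittleO_nhds_zero, Asymptotics.isLittleO_iff]
  intro ε hε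
  set η : ℝ := ε / (2 * (‖u‖ ^ (p - 1) + 1)) with hη
  have hη0 : 0 < η := by positivity
  obtain ⟨C, hC0, hC⟩ := abs_add_rpow_taylor_bound hp hη0
  have hsmall : ∀ᶠ v : Lp ℝ (ENNReal.ofReal p) μ in 𝓝 0, C * ‖v‖ ^ (p - 1) ≤ ε / 2 := by
    have : Tendsto (fun v : Lp ℝ (ENNReal.ofReal p) μ => C * ‖v‖ ^ (p - 1)) (𝓝 0)
        (𝓝 (C * ‖(0 : Lp ℝ (ENNReal.ofReal p) μ)‖ ^ (p - 1))) :=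
      ((continuous_norm.rpow_const fun _ => Or.inr (by linarith)).const_mul C).tendsto _
    rw [norm_zero, Real.zero_rpow (by linarith), mul_zero] at this
    exact this.eventually (ge_mem_nhds (by positivity))
  filter_upwards [hsmall] with v hv
  have e : ∫ x, |(u + v : Lp ℝ (ENNReal.ofReal p) μ) x| ^ p ∂μ - ∫ x, |u x| ^ p ∂μ - (p • T) v =
      ∫ x, (|u x + v x| ^ p - |u x| ^ p - p * (|u x| ^ (p - 2) * u x) * v x) ∂μ := by
    have e1 : ∫ x, |(u + v : Lp ℝ (ENNReal.ofReal p) μ) x| ^ p ∂μ = ∫ x, |u x + v x| ^ p ∂μ := by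
      refine integral_congr_ae ?_
      filter_upwards [Lp.coeFn_add u v] with x hx
      rw [hx, Pi.add_apply]
    have i1 : Integrable (fun x => |u x + v x| ^ p) μ := by
      refine (integrable_abs_rpow hp (u + v)).congr ?_
      filter_upwards [Lp.coeFn_add u v] with x hx
      rw [hx, Pi.add_apply]
    have i3 : Integrable (fun x => p * (|u x| ^ (p - 2) * u x) * v x) μ := by
      simpa only [mul_assoc] using (integrable_abs_rpow_mul_mul hp u v).const_mul p
    rw [integral_sub (f := fun x => |u x + v x| ^ p - |u x| ^ p)
      (i1.sub (integrable_abs_rpow hp u)) i3, integral_sub i1 (integrable_abs_rpow hp u), e1, _root_.smul_apply, hT,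
      smul_eq_mul, ← integral_const_mul]
    simp only [mul_assoc]
  rw [e]
  have hint : Integrable (fun x => η * (|u x| ^ (p - 1) * |v x|) + C * |v x| ^ p) μ :=
    ((integrable_abs_rpow_sub_one_mul hp u v).const_mul η).add
      ((integrable_abs_rpow hp v).const_mul C)
  calc _ ≤ ∫ x, (η * (|u x| ^ (p - 1) * |v x|) + C * |v x| ^ p) ∂μ :=
        norm_integral_le_of_norm_le hint (Eventually.of_forall fun x => hC _ _)
    _ = η * ∫ x, |u x| ^ (p - 1) * |v x| ∂μ + C * ‖v‖ ^ p := by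
      rw [integral_add ((integrable_abs_rpow_sub_one_mul hp u v).const_mul η)
        ((integrable_abs_rpow hp v).const_mul C), integral_const_mul, integral_const_mul,
        integral_abs_rpow_eq hp]
    _ ≤ η * ((‖u‖ ^ (p - 1) + 1) * ‖v‖) + C * ‖v‖ ^ (p - 1) * ‖v‖ := by
      have h1 := integral_abs_rpow_sub_one_mul_le hp u v
      have h2 : ‖v‖ ^ p = ‖v‖ ^ (p - 1) * ‖v‖ := by
        rcases eq_or_ne ‖v‖ 0 with h0 | h0
        · rw [h0, Real.zero_rpow (by linarith), mul_zero]
        · rw [Real.rpow_sub_one h0]; field_simp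
      rw [h2, mul_assoc C]
      gcongr
      refine h1.trans ?_
      gcongr
      linarith
    _ ≤ ε / 2 * ‖v‖ + ε / 2 * ‖v‖ := by
      refine add_le_add (le_of_eq ?_) (mul_le_mul_of_nonneg_right hv (norm_nonneg _))
      rw [hη]
      field_simp
    _ = ε * ‖v‖ := by ring

end Lp

end

section

/-- Bounded sequences of a separable Hilbert space have weakly convergent subsequences. -/
lemma exists_weak_subseq {E : Type*} [NormedAddCommGroup E] [InnerProductSpace ℝ E]
    [CompleteSpace E] [TopologicalSpace.SeparableSpace E] {u : ℕ → E} {M : ℝ}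
    (hu : ∀ n, ‖u n‖ ≤ M) :
    ∃ σ : ℕ → ℕ, StrictMono σ ∧ ∃ v : E, ∀ ℓ : E →L[ℝ] ℝ,
      Tendsto (fun n => ℓ (u (σ n))) atTop (𝓝 (ℓ v)) := by
  let D := InnerProductSpace.toDual ℝ E
  obtain ⟨f, -, σ, hσ, hlim⟩ := WeakDual.isSeqCompact_closedBall ℝ E 0 M
    (x := fun n => StrongDual.toWeakDual (D (u n))) (fun n => by
      change D (u n) ∈ Metric.closedBall 0 M
      simpa using hu n)
  refine ⟨σ, hσ, D.symm (WeakDual.toStrongDual f), fun ℓ => ?_⟩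
  have h1 := (WeakBilin.tendsto_iff_forall_eval_tendsto _ ContinuousLinearMap.coe_injective).1
    hlim (D.symm ℓ)
  have h2 : ∀ z : E, ℓ z = inner ℝ z (D.symm ℓ) := fun z => by
    rw [real_inner_comm, InnerProductSpace.toDual_symm_apply]
  rw [h2]
  simp only [h2 (u _)]
  have h3 : inner ℝ (D.symm (WeakDual.toStrongDual f)) (D.symm ℓ) = f (D.symm ℓ) := by
    rw [InnerProductSpace.toDual_symm_apply]; rfl
  rw [h3]
  exact h1

lemma ENNReal_add_sq_le (a b : ℝ≥0∞) : (a + b) ^ 2 ≤ 2 * a ^ 2 + 2 * b ^ 2 := by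
  have := ENNReal.rpow_add_le_mul_rpow_add_rpow a b (p := 2) (by norm_num)
  norm_num at this
  rwa [mul_add] at this

variable {N : ℕ} {Ω : Set (Euc N)} {φ : Euc N → ℝ}

/-- The integral of `φ` over the ball `B(x, r)`. -/
def ballIntegral (r : ℝ) (φ : Euc N → ℝ) (x : Euc N) : ℝ :=
  ∫ y in Metric.ball (0 : Euc N) r, φ (x + y)

lemma ballIntegral_eq (r : ℝ) (φ : Euc N → ℝ) (x : Euc N) :
    ballIntegral r φ x = ∫ y in Metric.ball x r, φ y := by
  have h := (measurePreserving_add_left (volume : Measure (Euc N)) x).setIntegral_preimage_emb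
    (measurableEmbedding_addLeft x) φ (Metric.ball x r)
  rw [← h, ballIntegral]
  congr 2
  ext y
  simp

lemma measurable_ballIntegral (r : ℝ) (h : IsTest Ω φ) : Measurable (ballIntegral r φ) := by
  have hc : StronglyMeasurable fun z : Euc N × Euc N => φ (z.1 + z.2) :=
    (h.continuous.comp (continuous_fst.add continuous_snd)).stronglyMeasurable
  exact (hc.integral_prod_right (ν := volume.restrict (Metric.ball (0 : Euc N) r))).measurable

lemma enorm_ballIntegral_sq_le (r : ℝ) (h : IsTest Ω φ) (x : Euc N) :
    ‖ballIntegral r φ x‖ₑ ^ 2 ≤ volume (Metric.ball (0 : Euc N) r) * ∫⁻ y, ‖φ y‖ₑ ^ 2 := by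
  have hm : Measurable fun y => ‖φ (x + y)‖ₑ :=
    (h.continuous.comp (continuous_const.add continuous_id)).enorm.measurable
  calc ‖ballIntegral r φ x‖ₑ ^ 2
      ≤ (∫⁻ y in Metric.ball (0 : Euc N) r, 1 * ‖φ (x + y)‖ₑ) ^ 2 := by
        simp only [one_mul]
        gcongr
        exact enorm_integral_le_lintegral_enorm _
    _ ≤ _ := lintegral_mul_sq_le aemeasurable_const hm.aemeasurable
    _ ≤ volume (Metric.ball (0 : Euc N) r) * ∫⁻ y, ‖φ (x + y)‖ₑ ^ 2 := by
      simp only [one_pow, lintegral_const, one_mul, Measure.restrict_apply_univ]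
      gcongr
      exact Measure.restrict_le_self
    _ = _ := by rw [lintegral_add_left_eq_self (fun y => ‖φ y‖ₑ ^ 2)]

/-- A test function is `L^2`-close to its averages over small balls. -/
lemma lintegral_sq_le_ballIntegral (r : ℝ) (h : IsTest Ω φ) :
    volume (Metric.ball (0 : Euc N) r) ^ 2 * ∫⁻ x, ‖φ x‖ₑ ^ 2 ≤
      2 * (∫⁻ x, ‖ballIntegral r φ x‖ₑ ^ 2) + volume (Metric.ball (0 : Euc N) r) ^ 2 *
        (2 * ENNReal.ofReal r ^ 2 * ∫⁻ x, ‖∇ φ x‖ₑ ^ 2) := by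
  set B := Metric.ball (0 : Euc N) r with hB
  set V := volume B with hV
  have hVt : V ≠ ⊤ := measure_ball_lt_top.ne
  have hc2 : Continuous fun z : Euc N × Euc N => φ (z.1 + z.2) - φ z.1 :=
    (h.continuous.comp (continuous_fst.add continuous_snd)).sub (h.continuous.comp continuous_fst)
  have hm2 : Measurable fun z : Euc N × Euc N => ‖φ (z.1 + z.2) - φ z.1‖ₑ := hc2.enorm.measurable
  have hpt : ∀ x, V ^ 2 * ‖φ x‖ₑ ^ 2 ≤ 2 * ‖ballIntegral r φ x‖ₑ ^ 2 +
      2 * (V * ∫⁻ y in B, ‖φ (x + y) - φ x‖ₑ ^ 2) := by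
    intro x
    have hc : Continuous fun y => φ (x + y) := h.continuous.comp (continuous_const.add continuous_id)
    have hi : ∀ f : Euc N → ℝ, Continuous f → IntegrableOn f B := fun f hf =>
      (hf.continuousOn.integrableOn_compact (isCompact_closedBall 0 r)).mono_set Metric.ball_subset_closedBall
    have h1 : V * ‖φ x‖ₑ ≤ ‖ballIntegral r φ x‖ₑ + ∫⁻ y in B, 1 * ‖φ (x + y) - φ x‖ₑ := by
      have e : volume.real B * φ x = ballIntegral r φ x - ∫ y in B, (φ (x + y) - φ x) := by
        rw [ballIntegral, integral_sub (hi _ hc) (hi _ continuous_const)]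
        simp [hB]
      calc V * ‖φ x‖ₑ = ‖volume.real B * φ x‖ₑ := by
            rw [enorm_mul, Real.enorm_of_nonneg measureReal_nonneg, measureReal_def,
              ENNReal.ofReal_toReal hVt]
        _ ≤ _ := by
          rw [e]
          refine (enorm_sub_le).trans ?_
          simp only [one_mul]
          gcongr
          exact enorm_integral_le_lintegral_enorm _
    rw [← mul_pow]
    refine (pow_le_pow_left' h1 2).trans ((ENNReal_add_sq_le _ _).trans ?_)
    gcongr
    refine (lintegral_mul_sq_le aemeasurable_const
      (hm2.comp (measurable_const.prodMk measurable_id)).aemeasurable).trans_eq ?_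
    simp [hV]
  calc V ^ 2 * ∫⁻ x, ‖φ x‖ₑ ^ 2 = ∫⁻ x, V ^ 2 * ‖φ x‖ₑ ^ 2 := by
        rw [lintegral_const_mul' _ _ (by finiteness)]
    _ ≤ ∫⁻ x, (2 * ‖ballIntegral r φ x‖ₑ ^ 2 +
          2 * (V * ∫⁻ y in B, ‖φ (x + y) - φ x‖ₑ ^ 2)) := lintegral_mono hpt
    _ = 2 * (∫⁻ x, ‖ballIntegral r φ x‖ₑ ^ 2) +
          2 * (V * ∫⁻ y in B, ∫⁻ x, ‖φ (x + y) - φ x‖ₑ ^ 2) := by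
      rw [lintegral_add_left (((measurable_ballIntegral r h).enorm.pow_const 2).const_mul 2),
        lintegral_const_mul' _ _ (by simp), lintegral_const_mul' _ _ (by simp),
        lintegral_const_mul' _ _ hVt, lintegral_lintegral_swap]
      exact (hm2.pow_const 2).aemeasurable
    _ ≤ 2 * (∫⁻ x, ‖ballIntegral r φ x‖ₑ ^ 2) +
          2 * (V * ∫⁻ _ in B, ENNReal.ofReal r ^ 2 * ∫⁻ x, ‖∇ φ x‖ₑ ^ 2) := by
      refine add_le_add le_rfl (mul_le_mul_right (mul_le_mul_right ?_ V) 2)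
      refine setLIntegral_mono' Metric.isOpen_ball.measurableSet fun y hy => ?_
      refine (lintegral_translate_sub_le (h.mono (subset_univ _)) y).trans ?_
      gcongr
      rw [← ofReal_norm]
      exact ENNReal.ofReal_le_ofReal (mem_ball_zero_iff.1 hy).le
    _ = _ := by
      rw [lintegral_const, Measure.restrict_apply_univ]
      ring

/-- Weakly null sequences of test functions in a bounded set converge to zero in `L^2`. -/
lemma tendsto_lintegral_sq_of_weak (hΩ : Bornology.IsBounded Ω) {φ : ℕ → Euc N → ℝ}
    (hφ : ∀ n, IsTest Ω (φ n)) {M : ℝ≥0∞} (hM : M ≠ ⊤) (h1 : ∀ n, ∫⁻ x, ‖φ n x‖ₑ ^ 2 ≤ M)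
    (h2 : ∀ n, ∫⁻ x, ‖∇ (φ n) x‖ₑ ^ 2 ≤ M)
    (hw : ∀ x r, Tendsto (fun n => ∫ y in Metric.ball x r, φ n y) atTop (𝓝 0)) :
    Tendsto (fun n => ∫⁻ x, ‖φ n x‖ₑ ^ 2) atTop (𝓝 0) := by
  obtain ⟨R, hR⟩ := hΩ.subset_ball 0
  have key : ∀ r, 0 < r → r ≤ 1 →
      Tendsto (fun n => ∫⁻ x, ‖ballIntegral r (φ n) x‖ₑ ^ 2) atTop (𝓝 0) := by
    intro r hr hr1
    have := tendsto_lintegral_of_dominated_convergence (μ := (volume : Measure (Euc N)))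
      (F := fun n x => ‖ballIntegral r (φ n) x‖ₑ ^ 2) (f := fun _ => 0)
      ((Metric.closedBall (0 : Euc N) (R + 1)).indicator
        fun _ => volume (Metric.ball (0 : Euc N) r) * M)
      (fun n => (measurable_ballIntegral r (hφ n)).enorm.pow_const 2)
      (fun n => Eventually.of_forall fun x => ?_) ?_ (Eventually.of_forall fun x => ?_)
    · simpa using this
    · by_cases hx : x ∈ Metric.closedBall (0 : Euc N) (R + 1)
      · rw [indicator_of_mem hx]
        refine (enorm_ballIntegral_sq_le r (hφ n) x).trans ?_
        gcongr
        exact h1 n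
      · have h0 : ballIntegral r (φ n) x = 0 := by
          rw [ballIntegral_eq]
          refine setIntegral_eq_zero_of_forall_eq_zero fun y hy => (hφ n).eq_zero fun hyΩ => hx ?_
          have hy1 := mem_ball_zero_iff.1 (hR hyΩ)
          have hy2 : ‖y - x‖ < r := mem_ball_iff_norm.1 hy
          rw [mem_closedBall_zero_iff]
          have := norm_sub_norm_le x y
          rw [norm_sub_rev] at this
          linarith
        simp [h0]
    · rw [lintegral_indicator Metric.isClosed_closedBall.measurableSet, setLIntegral_const]
      exact ENNReal.mul_ne_top (ENNReal.mul_ne_top measure_ball_lt_top.ne hM)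
        measure_closedBall_lt_top.ne
    · have h3 := ENNReal.Tendsto.pow (n := 2) (hw x r).enorm
      simpa [ballIntegral_eq] using h3
  rw [ENNReal.tendsto_nhds_zero]
  intro δ hδ
  have hδ2 : 0 < δ / 2 := ENNReal.half_pos hδ.ne'
  have hsm : Tendsto (fun r : ℝ => 2 * ENNReal.ofReal r ^ 2 * M) (𝓝[>] 0) (𝓝 0) := by
    have h3 : Tendsto (fun r : ℝ => ENNReal.ofReal r) (𝓝[>] 0) (𝓝 0) := by
      simpa using (ENNReal.continuous_ofReal.tendsto 0).mono_left nhdsWithin_le_nhds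
    have h4 := ENNReal.Tendsto.mul_const (b := M)
      (ENNReal.Tendsto.const_mul (a := 2) (ENNReal.Tendsto.pow (n := 2) h3) (Or.inr (by simp))) (Or.inr hM)
    simpa using h4
  obtain ⟨r, hr, hr0, hr1⟩ := ((ENNReal.tendsto_nhds_zero.1 hsm _ hδ2).and
    (Ioo_mem_nhdsGT (zero_lt_one (α := ℝ)))).exists
  set V := volume (Metric.ball (0 : Euc N) r) with hV
  have hV0 : V ^ 2 ≠ 0 := pow_ne_zero _ (Metric.measure_ball_pos _ _ hr0).ne'
  have hVt : V ^ 2 ≠ ⊤ := ENNReal.pow_ne_top measure_ball_lt_top.ne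
  have hk : Tendsto (fun n => (V ^ 2)⁻¹ * (2 * ∫⁻ x, ‖ballIntegral r (φ n) x‖ₑ ^ 2))
      atTop (𝓝 0) := by
    have := ENNReal.Tendsto.const_mul (a := (V ^ 2)⁻¹) (ENNReal.Tendsto.const_mul (a := 2)
      (key r hr0 hr1.le) (Or.inr (by simp))) (Or.inr (ENNReal.inv_ne_top.2 hV0))
    simpa using this
  filter_upwards [ENNReal.tendsto_nhds_zero.1 hk _ hδ2] with n hn
  have h5 := lintegral_sq_le_ballIntegral r (hφ n)
  calc ∫⁻ x, ‖φ n x‖ₑ ^ 2 = (V ^ 2)⁻¹ * (V ^ 2 * ∫⁻ x, ‖φ n x‖ₑ ^ 2) := by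
        rw [← mul_assoc, ENNReal.inv_mul_cancel hV0 hVt, one_mul]
    _ ≤ (V ^ 2)⁻¹ * (2 * (∫⁻ x, ‖ballIntegral r (φ n) x‖ₑ ^ 2) + V ^ 2 *
        (2 * ENNReal.ofReal r ^ 2 * ∫⁻ x, ‖∇ (φ n) x‖ₑ ^ 2)) := by gcongr
    _ = (V ^ 2)⁻¹ * (2 * ∫⁻ x, ‖ballIntegral r (φ n) x‖ₑ ^ 2) +
        2 * ENNReal.ofReal r ^ 2 * ∫⁻ x, ‖∇ (φ n) x‖ₑ ^ 2 := by
      rw [mul_add, ← mul_assoc (V ^ 2)⁻¹ (V ^ 2), ENNReal.inv_mul_cancel hV0 hVt, one_mul]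
    _ ≤ δ / 2 + δ / 2 := add_le_add hn (le_trans (by gcongr; exact h2 n) hr)
    _ = δ := ENNReal.add_halves δ

/-- Rellich's theorem: weakly null sequences of `H^1_0(Ω)` converge to zero in `L^2`. -/
lemma rellich (hΩ : Bornology.IsBounded Ω) {u : ℕ → H10 N Ω} {M : ℝ} (hu : ∀ n, ‖u n‖ ≤ M)
    (hw : ∀ ℓ : H10 N Ω →L[ℝ] ℝ, Tendsto (fun n => ℓ (u n)) atTop (𝓝 0)) :
    Tendsto (fun n => (u n).1.fst) atTop (𝓝 0) := by
  have hM0 : 0 ≤ M := (norm_nonneg _).trans (hu 0)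
  have hex : ∀ n : ℕ, ∃ (φ : Euc N → ℝ) (v : H10 N Ω), IsPair Ω v.1 φ ∧
      ‖v - u n‖ < 1 / ((n : ℝ) + 1) := by
    intro n
    obtain ⟨φ, v, hv, hlim⟩ := exists_seq_isPair (u n)
    obtain ⟨m, hm⟩ := ((tendsto_iff_norm_sub_tendsto_zero.1 hlim).eventually
      (gt_mem_nhds (by positivity : (0 : ℝ) < 1 / ((n : ℝ) + 1)))).exists
    exact ⟨φ m, v m, hv m, hm⟩
  choose φ v hv hvu using hex
  have hd : Tendsto (fun n => v n - u n) atTop (𝓝 0) :=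
    squeeze_zero_norm (fun n => (hvu n).le) tendsto_one_div_add_atTop_nhds_zero_nat
  have hvM : ∀ n, ‖v n‖ ≤ M + 1 := by
    intro n
    have h1 : 1 / ((n : ℝ) + 1) ≤ 1 := by
      rw [div_le_one (by positivity)]; linarith [(n.cast_nonneg : (0 : ℝ) ≤ n)]
    have h2 := norm_add_le (u n) (v n - u n)
    rw [add_sub_cancel] at h2
    linarith [hu n, hvu n]
  have hcast : ∀ {F : Type} [NormedAddCommGroup F] (f : Lp F 2 (volume : Measure (Euc N)))
      (g : Euc N → F), f =ᵐ[volume] g → ∫⁻ x, ‖g x‖ₑ ^ 2 = ‖f‖ₑ ^ 2 := by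
    intro F _ f g hfg
    rw [← eLpNorm_two_sq, Lp.enorm_def, eLpNorm_congr_ae hfg]
  have hb : ∀ z : ℝ, z ≤ M + 1 → ENNReal.ofReal z ^ 2 ≤ ENNReal.ofReal (M + 1) ^ 2 := fun z hz => by
    gcongr
  have hL := tendsto_lintegral_sq_of_weak hΩ (fun n => (hv n).test)
    (M := ENNReal.ofReal (M + 1) ^ 2) (by finiteness)
    (fun n => by
      rw [hcast _ _ (hv n).fst, ← ofReal_norm]
      exact hb _ ((WithLp.norm_fst_le _ _).trans (hvM n)))
    (fun n => by
      rw [hcast _ _ (hv n).snd, ← ofReal_norm]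
      exact hb _ ((WithLp.norm_snd_le _ _).trans (hvM n)))
    (fun x r => by
      have hB : MeasurableSet (Metric.ball x r) := Metric.isOpen_ball.measurableSet
      have hBt : volume (Metric.ball x r) ≠ ⊤ := measure_ball_lt_top.ne
      let ℓ : H10 N Ω →L[ℝ] ℝ :=
        (innerSL ℝ (indicatorConstLp 2 hB hBt (1 : ℝ))).comp (fstCLM N Ω 2)
      have h1 : Tendsto (fun n => ℓ (v n)) atTop (𝓝 0) := by
        have := ((ℓ.continuous.tendsto 0).comp hd).add (hw ℓ)
        simpa [Function.comp_def, map_sub] using this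
      refine h1.congr fun n => ?_
      have : ℓ (v n) = inner ℝ (indicatorConstLp 2 hB hBt (1 : ℝ)) (v n).1.fst := rfl
      rw [this, L2.inner_indicatorConstLp_one]
      exact setIntegral_congr_ae hB ((hv n).fst.mono fun x hx _ => hx))
  have h0 : Tendsto (fun n => (v n).1.fst) atTop (𝓝 0) := by
    rw [tendsto_zero_iff_norm_tendsto_zero]
    have h1 : Tendsto (fun n => ‖(v n).1.fst‖ₑ ^ 2) atTop (𝓝 0) :=
      hL.congr fun n => hcast _ _ (hv n).fst
    have h2 : Tendsto (fun n => ‖(v n).1.fst‖ ^ 2) atTop (𝓝 0) := by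
      have := (ENNReal.tendsto_toReal ENNReal.zero_ne_top).comp h1
      simpa [Function.comp_def] using this
    have h3 := h2.sqrt
    simpa using h3
  have h4 := h0.sub (((fstCLM N Ω 2).continuous.tendsto 0).comp hd)
  simpa [Function.comp_def] using h4

end

section

variable {N : ℕ} {Ω : Set (Euc N)} {φ : Euc N → ℝ}

lemma angularPotential_eq_of_extend {h : Sph N → ℝ} {H : Euc N → ℝ} (hH : ∀ s : Sph N, H s = h s)
    (x : Euc N) : angularPotential h x = H (‖x‖⁻¹ • x) / ‖x‖ ^ 2 := by
  rw [angularPotential]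
  split_ifs with hx
  · simp [hx]
  · rw [← hH]

lemma measurable_angularPotential {h : Sph N → ℝ} (hc : Continuous h) :
    Measurable (angularPotential h) := by
  obtain ⟨H, hH⟩ := ContinuousMap.exists_restrict_eq (Metric.isClosed_sphere (x := (0 : Euc N))
    (ε := 1)) (⟨h, hc⟩ : C(Sph N, ℝ))
  have hH' : ∀ s : Sph N, H s = h s := fun s => congrArg (fun f => f s) hH
  have : angularPotential h = fun x => H (‖x‖⁻¹ • x) / ‖x‖ ^ 2 :=
    funext fun x => angularPotential_eq_of_extend hH' x
  rw [this]
  have := H.continuous.measurable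
  fun_prop

lemma exists_abs_angularPotential_le {h : Sph N → ℝ} (hc : Continuous h) :
    ∃ C, 0 ≤ C ∧ ∀ x, |angularPotential h x| ≤ C / ‖x‖ ^ 2 := by
  obtain ⟨C, hC⟩ := isCompact_univ.exists_bound_of_continuousOn (f := h) hc.continuousOn
  refine ⟨max C 0, le_max_right _ _, fun x => ?_⟩
  rw [angularPotential]
  split_ifs with hx
  · simp [hx]
  · rw [abs_div, abs_of_nonneg (by positivity : 0 ≤ ‖x‖ ^ 2)]
    gcongr
    exact (hC _ (mem_univ _)).trans (le_max_left _ _)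

lemma angularPotential_smul {h : Sph N → ℝ} {s : ℝ} (hs : 0 < s) (x : Euc N) :
    angularPotential h (s • x) = s⁻¹ ^ 2 * angularPotential h x := by
  rcases eq_or_ne x 0 with rfl | hx
  · simp [angularPotential]
  have hsx : s • x ≠ 0 := smul_ne_zero hs.ne' hx
  simp only [angularPotential, hx, hsx, dif_neg, not_false_eq_true]
  have e : ‖s • x‖⁻¹ • s • x = ‖x‖⁻¹ • x := by
    rw [norm_smul, Real.norm_of_nonneg hs.le, smul_smul]
    congr 1
    field_simp
  have e' : ‖s • x‖ ^ 2 = s ^ 2 * ‖x‖ ^ 2 := by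
    rw [norm_smul, Real.norm_of_nonneg hs.le, mul_pow]
  simp only [e, e']
  field_simp

/-- Dilations and translations of test functions. -/
lemma IsTest.exists_scale (hφ : IsTest univ φ) : ∃ R, 0 < R ∧ ∀ s : ℝ, 0 < s → ∀ a : Euc N,
    IsTest (Metric.closedBall a (R / s)) (fun x => φ (s • (x - a))) := by
  obtain ⟨R, hR0, hR⟩ := hφ.compact.isCompact.isBounded.subset_ball_lt 0 0
  refine ⟨R, hR0, fun s hs a => ?_⟩
  have hsupp : Function.support (fun x => φ (s • (x - a))) ⊆ Metric.closedBall a (R / s) := by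
    intro x hx
    have h1 := mem_ball_zero_iff.1 (hR (subset_tsupport φ hx))
    rw [norm_smul, Real.norm_of_nonneg hs.le] at h1
    rw [mem_closedBall_iff_norm, le_div_iff₀ hs]
    linarith
  refine ⟨hφ.smooth.comp (by fun_prop), HasCompactSupport.of_support_subset_isCompact
    (isCompact_closedBall _ _) hsupp, closure_minimal hsupp Metric.isClosed_closedBall⟩

lemma gradient_scale (hφ : Differentiable ℝ φ) (s : ℝ) (a x : Euc N) :
    ∇ (fun x => φ (s • (x - a))) x = s • ∇ φ (s • (x - a)) := by
  have h1 : HasFDerivAt (fun x : Euc N => s • (x - a)) (s • ContinuousLinearMap.id ℝ (Euc N)) x :=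
    ((hasFDerivAt_id x).sub_const a).const_smul s
  have h2 := ((hφ (s • (x - a))).hasFDerivAt.comp x h1).fderiv
  have h3 : fderiv ℝ (fun x => φ (s • (x - a))) x = s • fderiv ℝ φ (s • (x - a)) := by
    refine h2.trans ?_
    ext z
    simp
  rw [gradient, h3, gradient, map_smul]

lemma integral_scale (F : Euc N → ℝ) {s : ℝ} (hs : 0 < s) (a : Euc N) :
    ∫ x, F (s • (x - a)) = (s ^ N)⁻¹ * ∫ x, F x := by
  rw [integral_sub_right_eq_self (fun x => F (s • x)) a,
    Measure.integral_comp_smul_of_nonneg (μ := (volume : Measure (Euc N))) F s (hR := hs.le)]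
  simp

/-- Hardy's inequality with pole `a`. -/
lemma exists_hardy_pole (N : ℕ) [Fact (3 ≤ N)] : ∃ C : ℝ, 0 ≤ C ∧ ∀ (a : Euc N) (φ : Euc N → ℝ),
    IsTest univ φ → eLpNorm (fun x => ‖x - a‖⁻¹ * φ x) 2 volume ≤
      ENNReal.ofReal C * eLpNorm (fun x => ∇ φ x) 2 volume := by
  obtain ⟨C, hC0, hC⟩ := exists_hardy N
  refine ⟨C, hC0, fun a φ hφ => ?_⟩
  obtain ⟨R, -, hR⟩ := hφ.exists_scale
  have hψ := (hR 1 one_pos (-a)).mono (subset_univ _)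
  have h1 := hC _ hψ
  have hg := gradient_scale hφ.differentiable 1 (-a)
  simp only [hg] at h1
  simp only [one_smul, sub_neg_eq_add] at h1
  have hmp := measurePreserving_add_right (volume : Measure (Euc N)) a
  have e1 := eLpNorm_comp_measurePreserving (p := 2) (g := fun x => ‖x - a‖⁻¹ * φ x)
    ((by fun_prop : Measurable fun x : Euc N => ‖x - a‖⁻¹).mul
      hφ.continuous.measurable).aestronglyMeasurable hmp
  have e2 := eLpNorm_comp_measurePreserving (p := 2) (g := fun x => ∇ φ x)
    hφ.continuous_gradient.aestronglyMeasurable hmp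
  simp only [Function.comp_def, add_sub_cancel_right] at e1 e2
  rwa [← e1, ← e2]

/-- `W` is measurable and dominated by `C / |x - a|²`. -/
structure IsHardyPotential (a : Euc N) (W : Euc N → ℝ) : Prop where
  meas : Measurable W
  bound : ∃ C, 0 ≤ C ∧ ∀ x, |W x| ≤ C / ‖x - a‖ ^ 2

lemma isHardyPotential_angular {h : Sph N → ℝ} (hc : Continuous h) (a : Euc N) :
    IsHardyPotential a fun x => angularPotential h (x - a) := by
  obtain ⟨C, hC0, hC⟩ := exists_abs_angularPotential_le hc
  exact ⟨(measurable_angularPotential hc).comp (by fun_prop), C, hC0, fun x => hC _⟩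

lemma IsTest.integrable_gradient_sq (hφ : IsTest Ω φ) : Integrable fun x => ‖∇ φ x‖ ^ 2 :=
  (hφ.memLp_gradient 2).integrable_norm_pow (by simp)

lemma IsTest.integrable_sq (hφ : IsTest Ω φ) : Integrable fun x => φ x ^ 2 :=
  (hφ.memLp 2).integrable_sq

/-- The quadratic form of the Schrödinger operator `-Δ - W`. -/
def schrodingerForm (W : Euc N → ℝ) (φ : Euc N → ℝ) : ℝ := ∫ x, (‖∇ φ x‖ ^ 2 - W x * φ x ^ 2)

lemma exists_form_of_mul {E : Type*} [NormedAddCommGroup E] [NormedSpace ℝ E]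
    (T₁ T₂ : E →L[ℝ] Lp ℝ 2 (volume : Measure (Euc N))) {f : E → Euc N → ℝ} {g₁ g₂ W : Euc N → ℝ}
    (h₁ : ∀ w, T₁ w =ᵐ[volume] fun x => g₁ x * f w x)
    (h₂ : ∀ w, T₂ w =ᵐ[volume] fun x => g₂ x * f w x) (hW : ∀ x, g₁ x * g₂ x = W x) :
    ∃ B : E →L[ℝ] E →L[ℝ] ℝ, (∀ w v, B w v = B v w) ∧
      (∀ w v, B w v = ∫ x, W x * f w x * f v x) ∧
      ∀ w v, Integrable fun x => W x * f w x * f v x := by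
  have key : ∀ w v, ∀ᵐ x, inner ℝ (T₁ w x) (T₂ v x) = W x * f w x * f v x := by
    intro w v
    filter_upwards [h₁ w, h₂ v] with x h1 h2
    rw [h1, h2, ← hW]
    have : inner ℝ (g₁ x * f w x) (g₂ x * f v x) = g₂ x * f v x * (g₁ x * f w x) := by
      simp [inner]
    rw [this]
    ring
  have hB : ∀ w v, ((innerSL ℝ (E := Lp ℝ 2 (volume : Measure (Euc N)))).bilinearComp T₁ T₂) w v =
      ∫ x, W x * f w x * f v x := fun w v => by
    rw [ContinuousLinearMap.bilinearComp_apply, innerSL_apply_apply, L2.inner_def]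
    exact integral_congr_ae (key w v)
  refine ⟨_, fun w v => ?_, hB, fun w v => ?_⟩
  · rw [hB, hB]
    congr 1
    ext x
    ring
  · exact (L2.integrable_inner (𝕜 := ℝ) (T₁ w) (T₂ v)).congr (key w v)

variable [Fact (3 ≤ N)] {a : Euc N} {W : Euc N → ℝ} {p : ℝ≥0∞} [Fact (1 ≤ p)]

/-- Hardy potentials define bounded bilinear forms. -/
lemma IsHardyPotential.exists_form (hW : IsHardyPotential a W) (p : ℝ≥0∞) [Fact (1 ≤ p)]
    (Ω : Set (Euc N)) :
    ∃ B : TestClosure N p Ω →L[ℝ] TestClosure N p Ω →L[ℝ] ℝ,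
      (∀ w v, B w v = B v w) ∧ (∀ w v, B w v = ∫ x, W x * w.1.fst x * v.1.fst x) ∧
      ∀ w v : TestClosure N p Ω, Integrable fun x => W x * w.1.fst x * v.1.fst x := by
  obtain ⟨C, hC0, hC⟩ := hW.bound
  obtain ⟨K, hK0, hK⟩ := exists_hardy_pole N
  choose T₂ hT₂ _ using exists_mulCLM (Ω := Ω) (q := 2) (g := fun x => ‖x - a‖⁻¹) (by fun_prop)
    (fun φ hφ => hK a φ (hφ.mono (subset_univ _))) p
  have hg1 : Measurable fun x => W x * ‖x - a‖ := hW.meas.mul (by fun_prop)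
  have hg1b : ∀ x, |W x * ‖x - a‖| ≤ C * ‖x - a‖⁻¹ := by
    intro x
    rcases eq_or_ne (‖x - a‖) 0 with h0 | h0
    · simp [h0]
    rw [abs_mul, abs_norm]
    calc |W x| * ‖x - a‖ ≤ C / ‖x - a‖ ^ 2 * ‖x - a‖ := by gcongr; exact hC x
      _ = _ := by field_simp
  choose T₁ hT₁ _ using exists_mulCLM (Ω := Ω) (q := 2) hg1 (C := C * K) (fun φ hφ => by
    have h1 : eLpNorm (fun x => W x * ‖x - a‖ * φ x) 2 volume ≤
        ENNReal.ofReal C * eLpNorm (fun x => ‖x - a‖⁻¹ * φ x) 2 volume := by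
      refine eLpNorm_le_mul_eLpNorm_of_ae_le_mul (Eventually.of_forall fun x => ?_) 2
      rw [norm_mul, norm_mul (‖x - a‖⁻¹), ← mul_assoc, Real.norm_eq_abs, norm_inv, norm_norm]
      gcongr
      exact hg1b x
    refine h1.trans ?_
    rw [ENNReal.ofReal_mul hC0, mul_assoc]
    gcongr
    exact hK a φ (hφ.mono (subset_univ _))) p
  refine exists_form_of_mul T₁ T₂ hT₁ hT₂ fun x => ?_
  rcases eq_or_ne (‖x - a‖) 0 with h0 | h0
  · have hx := hC x
    rw [h0] at hx
    have : W x = 0 := by simpa using hx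
    simp [this]
  · field_simp

lemma IsHardyPotential.integrable (hW : IsHardyPotential a W) (hφ : IsTest univ φ) :
    Integrable fun x => W x * φ x ^ 2 := by
  obtain ⟨B, -, -, hB⟩ := hW.exists_form 2 univ
  obtain ⟨w, hw⟩ := hφ.exists_isPair 2
  refine (hB w w).congr ?_
  filter_upwards [hw.fst] with x hx
  rw [hx]
  ring

lemma IsHardyPotential.nonneg_of_tests (hW : IsHardyPotential a W)
    (h : ∀ φ, IsTest univ φ → 0 ≤ schrodingerForm W φ) (w : TestClosure N p univ) :
    0 ≤ ∫ x, (‖w.1.snd x‖ ^ 2 - W x * w.1.fst x ^ 2) := by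
  obtain ⟨B, -, hB, hBi⟩ := hW.exists_form p univ
  have e : ∀ w : TestClosure N p univ,
      ∫ x, (‖w.1.snd x‖ ^ 2 - W x * w.1.fst x ^ 2) = ‖w.1.snd‖ ^ 2 - B w w := by
    intro w
    rw [hB, norm_sq_Lp_two, ← integral_sub ((Lp.memLp w.1.snd).integrable_norm_pow (by simp))
      (hBi w w)]
    congr 1
    ext x
    ring
  refine closure_induction (P := fun w : TestClosure N p univ =>
    0 ≤ ∫ x, (‖w.1.snd x‖ ^ 2 - W x * w.1.fst x ^ 2)) ?_ (fun w φ hw => ?_) w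
  · simp only [e]
    refine isClosed_le continuous_const (Continuous.sub ?_ ?_)
    · exact ((sndCLM N univ p).continuous.norm).pow 2
    · exact B.continuous.clm_apply continuous_id
  · refine (h φ hw.test).trans_eq (integral_congr_ae ?_)
    filter_upwards [hw.fst, hw.snd] with x h1 h2
    rw [h1, h2]

end

section

variable {N k : ℕ} {Ω : Set (Euc N)} {φ : Euc N → ℝ} {W : Euc N → ℝ}

lemma IsPair.formQ_eq {a : Fin k → Euc N} {h : Fin k → Sph N → ℝ} {w : H10 N Ω}
    (hw : IsPair Ω w.1 φ) : formQ Ω a h w =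
      (∫ x, ‖∇ φ x‖ ^ 2) - ∑ i, ∫ x, angularPotential (h i) (x - a i) * φ x ^ 2 := by
  rw [formQ, setIntegral_snd, hw.norm_snd_sq]
  congr 1
  refine Finset.sum_congr rfl fun i _ => integral_congr_ae ?_
  filter_upwards [hw.fst] with x hx
  rw [hx]

lemma schrodingerForm_eq (hφ : IsTest Ω φ) (hW : Integrable fun x => W x * φ x ^ 2) :
    schrodingerForm W φ = (∫ x, ‖∇ φ x‖ ^ 2) - ∫ x, W x * φ x ^ 2 :=
  integral_sub hφ.integrable_gradient_sq hW

/-- Positivity of `Q_Ω` passes to the single-pole forms by concentration at the poles. -/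
lemma schrodingerForm_nonneg [Fact (3 ≤ N)] (hΩ : IsOpen Ω) {a : Fin k → Euc N}
    (ha : Function.Injective a) (haΩ : ∀ i, a i ∈ Ω) {h : Fin k → Sph N → ℝ}
    (hh : ∀ i, Continuous (h i)) (hQ : FormPosDef Ω a h) (i : Fin k) (hφ : IsTest univ φ) :
    0 ≤ schrodingerForm (angularPotential (h i)) φ := by
  classical
  obtain ⟨R, hR0, hR⟩ := hφ.exists_scale
  obtain ⟨κ, hκ, hQκ⟩ := hQ
  have hnear : ∀ᶠ y in 𝓝 (a i), y ∈ Ω ∧ ∀ j, j ≠ i → y ≠ a j := by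
    refine (hΩ.eventually_mem (haΩ i)).and (eventually_all.2 fun j => ?_)
    by_cases hj : j = i
    · simp [hj]
    · filter_upwards [isOpen_ne.mem_nhds (ha.ne (Ne.symm hj))] with y hy _ using hy
  obtain ⟨δ, hδ, hball⟩ := Metric.eventually_nhds_iff_ball.1 hnear
  have hdist : ∀ j, j ≠ i → δ ≤ dist (a j) (a i) := fun j hj => by
    by_contra hlt
    exact (hball (a j) (not_le.1 hlt)).2 j hj rfl
  choose C hC0 hC using fun j => exists_abs_angularPotential_le (hh j)
  set K : ℝ := ∑ j ∈ Finset.univ.erase i, C j / (δ / 2) ^ 2 with hK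
  have key : ∀ s : ℝ, 2 * R / δ ≤ s → 0 < s →
      0 ≤ schrodingerForm (angularPotential (h i)) φ + s⁻¹ ^ 2 * (K * ∫ x, φ x ^ 2) := by
    intro s hs hs0
    have hRs : R / s ≤ δ / 2 := by
      rw [div_le_iff₀ hδ] at hs
      rw [div_le_iff₀ hs0]
      linarith
    have hψ' := hR s hs0 (a i)
    set ψ : Euc N → ℝ := fun x => φ (s • (x - a i)) with hψdef
    have hψ : IsTest Ω ψ := hψ'.mono fun y hy =>
      (hball y (lt_of_le_of_lt (Metric.mem_closedBall.1 hy) (by linarith))).1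
    obtain ⟨w, hw⟩ := hψ.exists_isPair 2
    have hpos : 0 ≤ formQ Ω a h w :=
      le_trans (mul_nonneg hκ.le (integral_nonneg fun x => by positivity)) (hQκ w)
    rw [hw.formQ_eq, ← Finset.add_sum_erase _ _ (Finset.mem_univ i)] at hpos
    have e1 : ∫ x, ‖∇ ψ x‖ ^ 2 = s ^ 2 * ((s ^ N)⁻¹ * ∫ x, ‖∇ φ x‖ ^ 2) := by
      rw [← integral_scale _ hs0 (a i), ← integral_const_mul]
      congr 1
      ext x
      rw [gradient_scale hφ.differentiable, norm_smul, mul_pow, Real.norm_of_nonneg hs0.le]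
    have e2 : ∫ x, angularPotential (h i) (x - a i) * ψ x ^ 2 =
        s ^ 2 * ((s ^ N)⁻¹ * ∫ x, angularPotential (h i) x * φ x ^ 2) := by
      rw [← integral_scale _ hs0 (a i), ← integral_const_mul]
      congr 1
      ext x
      rw [angularPotential_smul hs0]
      field_simp
      rfl
    have e3 : ∫ x, ψ x ^ 2 = (s ^ N)⁻¹ * ∫ x, φ x ^ 2 :=
      integral_scale (fun x => φ x ^ 2) hs0 (a i)
    have e4 : -(K * ∫ x, ψ x ^ 2) ≤
        ∑ j ∈ Finset.univ.erase i, ∫ x, angularPotential (h j) (x - a j) * ψ x ^ 2 := by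
      rw [hK, Finset.sum_mul, ← Finset.sum_neg_distrib]
      refine Finset.sum_le_sum fun j hj => ?_
      have hj' : j ≠ i := Finset.ne_of_mem_erase hj
      rw [← integral_const_mul, ← integral_neg]
      refine integral_mono (hψ.integrable_sq.const_mul _).neg
        ((isHardyPotential_angular (hh j) (a j)).integrable (hψ.mono (subset_univ _))) fun x => ?_
      simp only
      rw [← neg_mul]
      by_cases hx : x ∈ Metric.closedBall (a i) (R / s)
      · refine mul_le_mul_of_nonneg_right ?_ (sq_nonneg _)
        refine le_trans ?_ (neg_le_of_abs_le (hC j (x - a j)))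
        refine neg_le_neg (div_le_div_of_nonneg_left (hC0 j) (by positivity) ?_)
        gcongr
        have h1 := hdist j hj'
        have h2 := dist_triangle (a j) x (a i)
        have h3 := Metric.mem_closedBall.1 hx
        rw [dist_comm, dist_eq_norm] at h2
        rw [dist_comm (a j) (a i), dist_eq_norm] at h1
        rw [dist_comm (a j) x, dist_eq_norm x (a j)] at h2
        linarith
      · rw [hψ'.eq_zero hx]
        simp
    have hi := schrodingerForm_eq hφ (by
      simpa using (isHardyPotential_angular (hh i) 0).integrable hφ)
    rw [e1, e2] at hpos
    rw [e3] at e4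
    rw [hi]
    have h5 : 0 ≤ s ^ 2 * (s ^ N)⁻¹ * ((∫ x, ‖∇ φ x‖ ^ 2) -
        (∫ x, angularPotential (h i) x * φ x ^ 2) + s⁻¹ ^ 2 * (K * ∫ x, φ x ^ 2)) := by
      have : s ^ 2 * (s ^ N)⁻¹ * (s⁻¹ ^ 2 * (K * ∫ x, φ x ^ 2)) =
          K * ((s ^ N)⁻¹ * ∫ x, φ x ^ 2) := by
        field_simp
      rw [mul_add, this]
      linarith
    exact nonneg_of_mul_nonneg_right h5 (by positivity)
  have hlim : Tendsto (fun s : ℝ => schrodingerForm (angularPotential (h i)) φ +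
      s⁻¹ ^ 2 * (K * ∫ x, φ x ^ 2)) atTop
      (𝓝 (schrodingerForm (angularPotential (h i)) φ + 0 ^ 2 * (K * ∫ x, φ x ^ 2))) :=
    ((tendsto_inv_atTop_zero.pow 2).mul_const _).const_add _
  have := ge_of_tendsto hlim (by
    filter_upwards [eventually_ge_atTop (2 * R / δ), eventually_gt_atTop 0] with s h1 h2
      using key s h1 h2)
  simpa using this

/-- The square of the critical Lebesgue norm. -/
def critSq (φ : Euc N → ℝ) : ℝ := (∫ x, |φ x| ^ twoStar N) ^ (2 / twoStar N)

lemma critSq_congr {f g : Euc N → ℝ} (hfg : f =ᵐ[volume] g) : critSq f = critSq g := by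
  rw [critSq, critSq]
  congr 1
  refine integral_congr_ae ?_
  filter_upwards [hfg] with x hx
  rw [hx]

lemma critSq_nonneg (φ : Euc N → ℝ) : 0 ≤ critSq φ :=
  Real.rpow_nonneg (integral_nonneg fun x => by positivity) _

variable [Fact (3 ≤ N)]

lemma sobolevS_eq_singleS (N : ℕ) [Fact (3 ≤ N)] : sobolevS N = singleS (0 : Sph N → ℝ) := by
  simp [sobolevS, singleS, angularPotential]

lemma singleS_bddBelow {h : Sph N → ℝ} (hc : Continuous h)
    (h0 : ∀ φ, IsTest univ φ → 0 ≤ schrodingerForm (angularPotential h) φ)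
    (w : {w : D12 N // w ≠ 0}) :
    0 ≤ (∫ x, (‖w.1.1.snd x‖ ^ 2 - angularPotential h x * w.1.1.fst x ^ 2)) /
      (∫ x, |w.1.1.fst x| ^ twoStar N) ^ (2 / twoStar N) := by
  have hW : IsHardyPotential 0 (angularPotential h) := by
    simpa using isHardyPotential_angular hc 0
  exact div_nonneg (hW.nonneg_of_tests h0 w.1) (critSq_nonneg _)

lemma singleS_nonneg {h : Sph N → ℝ} (hc : Continuous h)
    (h0 : ∀ φ, IsTest univ φ → 0 ≤ schrodingerForm (angularPotential h) φ) : 0 ≤ singleS h :=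
  Real.iInf_nonneg (singleS_bddBelow hc h0)

lemma singleS_mul_critSq_le {h : Sph N → ℝ} (hc : Continuous h)
    (h0 : ∀ φ, IsTest univ φ → 0 ≤ schrodingerForm (angularPotential h) φ)
    (hφ : IsTest univ φ) :
    singleS h * critSq φ ≤ schrodingerForm (angularPotential h) φ := by
  have hp := two_lt_twoStar N
  by_cases hz : φ = 0
  · subst hz
    have : critSq (0 : Euc N → ℝ) = 0 := by
      rw [critSq]
      simp only [Pi.zero_apply, abs_zero, integral_const]
      rw [Real.zero_rpow (by linarith), smul_zero, Real.zero_rpow]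
      have : 0 < 2 / twoStar N := by positivity
      exact this.ne'
    rw [this, mul_zero]
    exact h0 _ hφ
  obtain ⟨w, hw⟩ := hφ.exists_isPair (ENNReal.ofReal (twoStar N))
  have hw0 : w ≠ 0 := by
    rintro rfl
    refine hz ?_
    have h1 : (fun _ => (0 : ℝ)) =ᵐ[volume] φ := by
      filter_upwards [hw.fst, Lp.coeFn_zero ℝ (ENNReal.ofReal (twoStar N))
        (volume : Measure (Euc N))] with x h1 h2
      rw [← h1]
      exact h2.symm
    exact ((continuous_const.ae_eq_iff_eq volume hφ.continuous).1 h1).symm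
  have hle := ciInf_le (f := fun w : {w : D12 N // w ≠ 0} =>
    (∫ x, (‖w.1.1.snd x‖ ^ 2 - angularPotential h x * w.1.1.fst x ^ 2)) /
      (∫ x, |w.1.1.fst x| ^ twoStar N) ^ (2 / twoStar N))
    ⟨0, by rintro _ ⟨w, rfl⟩; exact singleS_bddBelow hc h0 w⟩ ⟨w, hw0⟩
  have e1 : ∫ x, (‖w.1.snd x‖ ^ 2 - angularPotential h x * w.1.fst x ^ 2) =
      schrodingerForm (angularPotential h) φ := by
    refine integral_congr_ae ?_
    filter_upwards [hw.fst, hw.snd] with x h1 h2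
    rw [h1, h2]
  have e2 : (∫ x, |w.1.fst x| ^ twoStar N) ^ (2 / twoStar N) = critSq φ := critSq_congr hw.fst
  simp only [e1, e2] at hle
  have hpos : 0 < critSq φ := by
    refine Real.rpow_pos_of_pos ?_ _
    obtain ⟨x, hx⟩ := Function.ne_iff.1 hz
    refine Continuous.integral_pos_of_hasCompactSupport_nonneg_nonzero (x := x) ?_ ?_ ?_ ?_
    · exact hφ.continuous.abs.rpow_const fun _ => Or.inr (by linarith)
    · exact hφ.compact.comp_left (g := fun t : ℝ => |t| ^ twoStar N)
        (by simp [Real.zero_rpow (by linarith : twoStar N ≠ 0)])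
    · exact fun x => by positivity
    · exact (Real.rpow_pos_of_pos (abs_pos.2 hx) _).ne'
  exact (le_div_iff₀ hpos).1 hle

/-- Minkowski's inequality in `L^{2^*/2}`. -/
lemma critSq_le_add {f g φ : Euc N → ℝ} (hf : MemLp f (ENNReal.ofReal (twoStar N)) volume)
    (hg : MemLp g (ENNReal.ofReal (twoStar N)) volume) (h : ∀ x, φ x ^ 2 = f x ^ 2 + g x ^ 2) :
    critSq φ ≤ critSq f + critSq g := by
  have hp := two_lt_twoStar N
  have hq0 : ENNReal.ofReal (twoStar N / 2) ≠ 0 := by simp; linarith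
  have e : ∀ (u : Euc N → ℝ) (x), ‖u x ^ 2‖ ^ (twoStar N / 2) = |u x| ^ twoStar N := fun u x => by
    rw [norm_pow, Real.norm_eq_abs, ← Real.rpow_natCast, ← Real.rpow_mul (abs_nonneg _)]
    congr 1
    push_cast
    ring
  have hsq : ∀ u : Euc N → ℝ, MemLp u (ENNReal.ofReal (twoStar N)) volume →
      MemLp (fun x => u x ^ 2) (ENNReal.ofReal (twoStar N / 2)) volume := by
    intro u hu
    have hum : AEStronglyMeasurable (fun x => u x ^ 2) volume := hu.1.pow 2
    rw [← integrable_norm_rpow_iff hum hq0 ENNReal.ofReal_ne_top,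
      ENNReal.toReal_ofReal (by linarith)]
    simp only [e]
    have := hu.integrable_norm_rpow (by simp; linarith) ENNReal.ofReal_ne_top
    rwa [toReal_ofReal_twoStar] at this
  have heq : ∀ u : Euc N → ℝ, MemLp (fun x => u x ^ 2) (ENNReal.ofReal (twoStar N / 2)) volume →
      eLpNorm (fun x => u x ^ 2) (ENNReal.ofReal (twoStar N / 2)) volume =
        ENNReal.ofReal (critSq u) := by
    intro u hm
    rw [hm.eLpNorm_eq_integral_rpow_norm hq0 ENNReal.ofReal_ne_top,
      ENNReal.toReal_ofReal (by linarith)]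
    simp only [e]
    rw [critSq, inv_div]
  have h1 := hsq f hf
  have h2 := hsq g hg
  have hadd := eLpNorm_add_le h1.1 h2.1 (p := ENNReal.ofReal (twoStar N / 2)) (by
    rw [ENNReal.one_le_ofReal]; linarith)
  have h3 := h1.add h2
  have e4 : ((fun x => f x ^ 2) + fun x => g x ^ 2) = fun x => φ x ^ 2 := by
    ext x; simp [h]
  rw [e4] at hadd h3
  rw [heq f h1, heq g h2, heq φ h3, ← ENNReal.ofReal_add (critSq_nonneg _) (critSq_nonneg _)] at hadd
  exact (ENNReal.ofReal_le_ofReal_iff (add_nonneg (critSq_nonneg _) (critSq_nonneg _))).1 hadd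

end

section

variable {N k : ℕ} {Ω : Set (Euc N)} {φ : Euc N → ℝ} {W W₁ W₂ : Euc N → ℝ}

lemma IsTest.mul_left (hφ : IsTest Ω φ) {η : Euc N → ℝ} (hη : ContDiff ℝ ∞ η) :
    IsTest Ω (fun x => η x * φ x) :=
  ⟨hη.mul hφ.smooth, hφ.compact.mul_left, (tsupport_mul_subset_right).trans hφ.supp⟩

lemma gradient_mul {η φ : Euc N → ℝ} {x : Euc N} (hη : DifferentiableAt ℝ η x)
    (hφ : DifferentiableAt ℝ φ x) :
    ∇ (fun x => η x * φ x) x = η x • ∇ φ x + φ x • ∇ η x := by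
  rw [gradient, gradient, gradient, fderiv_fun_mul hη hφ]
  simp

/-- The IMS localization formula for the partition of unity `sin² θ + cos² θ = 1`. -/
lemma norm_gradient_sin_cos {θ : Euc N → ℝ} {x : Euc N} (hθ : DifferentiableAt ℝ θ x)
    (hφ : DifferentiableAt ℝ φ x) :
    ‖∇ (fun x => Real.sin (θ x) * φ x) x‖ ^ 2 + ‖∇ (fun x => Real.cos (θ x) * φ x) x‖ ^ 2 =
      ‖∇ φ x‖ ^ 2 + φ x ^ 2 * ‖∇ θ x‖ ^ 2 := by
  have hs : ∇ (fun x => Real.sin (θ x)) x = Real.cos (θ x) • ∇ θ x := by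
    rw [gradient, hθ.hasFDerivAt.sin.fderiv, gradient]
    simp
  have hc : ∇ (fun x => Real.cos (θ x)) x = -Real.sin (θ x) • ∇ θ x := by
    rw [gradient, hθ.hasFDerivAt.cos.fderiv, gradient]
    simp
  rw [gradient_mul hθ.sin hφ, gradient_mul hθ.cos hφ, hs, hc, norm_add_sq_real, norm_add_sq_real]
  simp only [norm_smul, inner_smul_left, inner_smul_right, norm_neg, Real.norm_eq_abs, mul_pow,
    sq_abs, conj_trivial]
  linear_combination (‖∇ φ x‖ ^ 2 + φ x ^ 2 * ‖∇ θ x‖ ^ 2) * Real.sin_sq_add_cos_sq (θ x)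

/-- The form of `-Δ - W` controls `m ‖φ‖²` in the critical Lebesgue norm up to `L^2` terms. -/
def HasCriticalBound (m : ℝ) (W : Euc N → ℝ) : Prop :=
  ∃ C, 0 ≤ C ∧ ∀ φ, IsTest univ φ → m * critSq φ - C * ∫ x, φ x ^ 2 ≤ schrodingerForm W φ

/-- Critical bounds can be glued by the IMS localization formula. -/
lemma HasCriticalBound.add [Fact (3 ≤ N)] {m : ℝ} (hm : 0 ≤ m)
    (h₁ : HasCriticalBound m W₁) (h₂ : HasCriticalBound m W₂)
    (hi₁ : ∀ φ, IsTest univ φ → Integrable fun x => W₁ x * φ x ^ 2)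
    (hi₂ : ∀ φ, IsTest univ φ → Integrable fun x => W₂ x * φ x ^ 2)
    {θ : Euc N → ℝ} (hθ : ContDiff ℝ ∞ θ) {L D₁ D₂ : ℝ} (hL : ∀ x, ‖∇ θ x‖ ≤ L)
    (hD₁ : ∀ x, W₁ x * Real.cos (θ x) ^ 2 ≤ D₁) (hD₂ : ∀ x, W₂ x * Real.sin (θ x) ^ 2 ≤ D₂) :
    HasCriticalBound m fun x => W₁ x + W₂ x := by
  obtain ⟨C₁, hC₁, hb₁⟩ := h₁
  obtain ⟨C₂, hC₂, hb₂⟩ := h₂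
  refine ⟨C₁ + C₂ + max (D₁ + D₂ + L ^ 2) 0, by positivity, fun φ hφ => ?_⟩
  have hs := hφ.mul_left (Real.contDiff_sin.comp hθ)
  have hc := hφ.mul_left (Real.contDiff_cos.comp hθ)
  simp only [Function.comp_apply] at hs hc
  have hθd : Differentiable ℝ θ := hθ.differentiable (by simp)
  have hmink := critSq_le_add (hs.memLp _) (hc.memLp _) (φ := φ) fun x => by
    linear_combination -φ x ^ 2 * Real.sin_sq_add_cos_sq (θ x)
  have hL2 : ∀ (η : Euc N → ℝ), IsTest univ (fun x => η x * φ x) → (∀ x, |η x| ≤ 1) →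
      ∫ x, (η x * φ x) ^ 2 ≤ ∫ x, φ x ^ 2 := by
    intro η hη h1
    refine integral_mono hη.integrable_sq hφ.integrable_sq fun x => ?_
    simp only
    rw [mul_pow, ← sq_abs (η x)]
    have := pow_le_one₀ (n := 2) (abs_nonneg (η x)) (h1 x)
    nlinarith [sq_nonneg (φ x)]
  have hs2 := hL2 _ hs fun x => Real.abs_sin_le_one _
  have hc2 := hL2 _ hc fun x => Real.abs_cos_le_one _
  have b₁ := hb₁ _ hs
  have b₂ := hb₂ _ hc
  have I₁ : Integrable fun x => ‖∇ (fun x => Real.sin (θ x) * φ x) x‖ ^ 2 -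
      W₁ x * (Real.sin (θ x) * φ x) ^ 2 := hs.integrable_gradient_sq.sub (hi₁ _ hs)
  have I₂ : Integrable fun x => ‖∇ (fun x => Real.cos (θ x) * φ x) x‖ ^ 2 -
      W₂ x * (Real.cos (θ x) * φ x) ^ 2 := hc.integrable_gradient_sq.sub (hi₂ _ hc)
  have I₁₂ : Integrable fun x => (‖∇ (fun x => Real.sin (θ x) * φ x) x‖ ^ 2 -
      W₁ x * (Real.sin (θ x) * φ x) ^ 2) + (‖∇ (fun x => Real.cos (θ x) * φ x) x‖ ^ 2 -
      W₂ x * (Real.cos (θ x) * φ x) ^ 2) := I₁.add I₂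
  have I₃ := hφ.integrable_sq.const_mul (max (D₁ + D₂ + L ^ 2) 0)
  have I₄ : Integrable fun x => (W₁ x + W₂ x) * φ x ^ 2 :=
    ((hi₁ _ hφ).add (hi₂ _ hφ)).congr (Eventually.of_forall fun x => (add_mul _ _ _).symm)
  have key : schrodingerForm W₁ (fun x => Real.sin (θ x) * φ x) +
      schrodingerForm W₂ (fun x => Real.cos (θ x) * φ x) -
      max (D₁ + D₂ + L ^ 2) 0 * ∫ x, φ x ^ 2 ≤ schrodingerForm (fun x => W₁ x + W₂ x) φ := by
    rw [schrodingerForm, schrodingerForm, schrodingerForm, ← integral_const_mul,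
      ← integral_add I₁ I₂, ← integral_sub I₁₂ I₃]
    refine integral_mono (I₁₂.sub I₃) (hφ.integrable_gradient_sq.sub I₄) fun x => ?_
    have e := norm_gradient_sin_cos (hθd x) (hφ.differentiable x)
    have hL0 : ‖∇ θ x‖ ^ 2 ≤ L ^ 2 := by gcongr; exact hL x
    have hmax := le_max_left (D₁ + D₂ + L ^ 2) 0
    have hφ0 := sq_nonneg (φ x)
    have h1 : (W₁ x * Real.cos (θ x) ^ 2 + W₂ x * Real.sin (θ x) ^ 2 + ‖∇ θ x‖ ^ 2 -
        max (D₁ + D₂ + L ^ 2) 0) * φ x ^ 2 ≤ 0 :=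
      mul_nonpos_of_nonpos_of_nonneg (by linarith [hD₁ x, hD₂ x]) hφ0
    have e2 := Real.sin_sq_add_cos_sq (θ x)
    beta_reduce
    have e3 : (W₁ x + W₂ x) * φ x ^ 2 * (Real.sin (θ x) ^ 2 + Real.cos (θ x) ^ 2) =
        (W₁ x + W₂ x) * φ x ^ 2 := by rw [e2, mul_one]
    simp only [mul_pow]
    linarith
  have hm' := mul_le_mul_of_nonneg_left hmink hm
  have t₁ := mul_le_mul_of_nonneg_left hs2 hC₁
  have t₂ := mul_le_mul_of_nonneg_left hc2 hC₂
  linarith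

lemma form_zero_nonneg (φ : Euc N → ℝ) :
    0 ≤ schrodingerForm (angularPotential (0 : Sph N → ℝ)) φ :=
  integral_nonneg fun x => by simp [angularPotential]

variable [Fact (3 ≤ N)]

lemma minS_le_sobolevS (h : Fin k → Sph N → ℝ) : minS h ≤ sobolevS N :=
  Finset.min'_le _ _ (Finset.mem_insert_self _ _)

lemma minS_le_singleS (h : Fin k → Sph N → ℝ) (i : Fin k) : minS h ≤ singleS (h i) :=
  Finset.min'_le _ _ (Finset.mem_insert_of_mem (Finset.mem_image_of_mem _ (Finset.mem_univ i)))

lemma minS_nonneg {h : Fin k → Sph N → ℝ} (hh : ∀ i, Continuous (h i))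
    (h0 : ∀ i φ, IsTest univ φ → 0 ≤ schrodingerForm (angularPotential (h i)) φ) :
    0 ≤ minS h := by
  refine Finset.le_min' _ _ _ fun y hy => ?_
  rcases Finset.mem_insert.1 hy with rfl | hy
  · rw [sobolevS_eq_singleS]
    exact singleS_nonneg continuous_const fun φ _ => form_zero_nonneg φ
  · obtain ⟨i, -, rfl⟩ := Finset.mem_image.1 hy
    exact singleS_nonneg (hh i) (h0 i)

lemma hasCriticalBound_single {h : Sph N → ℝ} (hc : Continuous h)
    (h0 : ∀ φ, IsTest univ φ → 0 ≤ schrodingerForm (angularPotential h) φ) {m : ℝ}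
    (hm : m ≤ singleS h) (a : Euc N) :
    HasCriticalBound m fun x => angularPotential h (x - a) := by
  refine ⟨0, le_rfl, fun φ hφ => ?_⟩
  rw [zero_mul, sub_zero]
  obtain ⟨R, -, hR⟩ := hφ.exists_scale
  have hψ := (hR 1 one_pos (-a)).mono (subset_univ _)
  have hg := gradient_scale hφ.differentiable 1 (-a)
  simp only [one_smul, sub_neg_eq_add] at hψ hg
  have e1 : critSq (fun x => φ (x + a)) = critSq φ := by
    rw [critSq, critSq, integral_add_right_eq_self (fun x => |φ x| ^ twoStar N)]
  have e2 : schrodingerForm (angularPotential h) (fun x => φ (x + a)) =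
      schrodingerForm (fun x => angularPotential h (x - a)) φ := by
    rw [schrodingerForm, schrodingerForm, ← integral_add_right_eq_self
      (fun x => ‖∇ φ x‖ ^ 2 - angularPotential h (x - a) * φ x ^ 2) a]
    simp only [hg, add_sub_cancel_right]
  have := singleS_mul_critSq_le hc h0 hψ
  rw [e1, e2] at this
  exact (mul_le_mul_of_nonneg_right hm (critSq_nonneg _)).trans this

/-- The multi-singular form controls `min {S, S(h_i)}` up to `L^2` terms. -/
lemma hasCriticalBound_sum {a : Fin k → Euc N} (ha : Function.Injective a)
    {h : Fin k → Sph N → ℝ} (hh : ∀ i, Continuous (h i))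
    (h0 : ∀ i φ, IsTest univ φ → 0 ≤ schrodingerForm (angularPotential (h i)) φ)
    (I : Finset (Fin k)) :
    HasCriticalBound (minS h) fun x => ∑ i ∈ I, angularPotential (h i) (x - a i) := by
  classical
  have hV : ∀ i, IsHardyPotential (a i) fun x => angularPotential (h i) (x - a i) :=
    fun i => isHardyPotential_angular (hh i) (a i)
  induction I using Finset.induction_on with
  | empty =>
    have := hasCriticalBound_single (h := (0 : Sph N → ℝ)) continuous_const
      (fun φ _ => form_zero_nonneg φ) (m := minS h)
      ((minS_le_sobolevS h).trans_eq (sobolevS_eq_singleS N)) 0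
    simpa [angularPotential] using this
  | insert j I hj ih =>
    simp only [Finset.sum_insert hj]
    obtain ⟨δ, hδ, hball⟩ := Metric.eventually_nhds_iff_ball.1
      (show ∀ᶠ y in 𝓝 (a j), ∀ i, i ∈ I → y ≠ a i from eventually_all.2 fun i => by
        by_cases hi : i ∈ I
        · have hij : i ≠ j := fun e => hj (e ▸ hi)
          filter_upwards [isOpen_ne.mem_nhds (ha.ne hij.symm)] with y hy _ using hy
        · simp [hi])
    have hdist : ∀ i ∈ I, δ ≤ ‖a i - a j‖ := fun i hi => by
      by_contra hlt
      exact hball (a i) (by rw [Metric.mem_ball, dist_eq_norm]; exact not_le.1 hlt) i hi rfl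
    let χ : ContDiffBump (a j) := ⟨δ / 4, δ / 2, by positivity, by linarith⟩
    have hθ : ContDiff ℝ ∞ fun x => Real.pi / 2 * χ x := contDiff_const.mul χ.contDiff
    have hθt : IsTest univ fun x => Real.pi / 2 * χ x :=
      ⟨hθ, χ.hasCompactSupport.mul_left, subset_univ _⟩
    obtain ⟨L, hL⟩ := hθt.continuous_gradient.bounded_above_of_compact_support
      hθt.hasCompactSupport_gradient
    choose C hC0 hC using fun i => (hV i).bound
    refine (hasCriticalBound_single (hh j) (h0 j) (minS_le_singleS h j) (a j)).add
      (minS_nonneg hh h0) ih (fun φ hφ => (hV j).integrable hφ) (fun φ hφ => ?_) hθ hL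
      (D₁ := C j / (δ / 4) ^ 2) (D₂ := ∑ i ∈ I, C i / (δ / 2) ^ 2) (fun x => ?_) fun x => ?_
    · simp only [Finset.sum_mul]
      exact integrable_finsetSum _ fun i _ => (hV i).integrable hφ
    · by_cases hx : x ∈ Metric.closedBall (a j) (δ / 4)
      · have : χ x = 1 := χ.one_of_mem_closedBall hx
        rw [this, mul_one, Real.cos_pi_div_two]
        simp only [ne_eq, OfNat.ofNat_ne_zero, not_false_eq_true, zero_pow, mul_zero]
        have := hC0 j
        positivity
      · have hx' : δ / 4 < ‖x - a j‖ := by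
          rwa [mem_closedBall_iff_norm, not_le] at hx
        have h1 : angularPotential (h j) (x - a j) ≤ C j / (δ / 4) ^ 2 := by
          refine (le_of_abs_le (hC j x)).trans ?_
          have := hC0 j
          gcongr
        have h2 : Real.cos (Real.pi / 2 * χ x) ^ 2 ≤ 1 := Real.cos_sq_le_one _
        have h3 := sq_nonneg (Real.cos (Real.pi / 2 * χ x))
        have h4 : 0 ≤ C j / (δ / 4) ^ 2 := by have := hC0 j; positivity
        calc _ ≤ C j / (δ / 4) ^ 2 * Real.cos (Real.pi / 2 * χ x) ^ 2 := by gcongr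
          _ ≤ C j / (δ / 4) ^ 2 * 1 := by gcongr
          _ = _ := mul_one _
    · have h4 : 0 ≤ ∑ i ∈ I, C i / (δ / 2) ^ 2 :=
        Finset.sum_nonneg fun i _ => by have := hC0 i; positivity
      by_cases hx : x ∈ Metric.ball (a j) (δ / 2)
      · have h1 : ∑ i ∈ I, angularPotential (h i) (x - a i) ≤ ∑ i ∈ I, C i / (δ / 2) ^ 2 := by
          refine Finset.sum_le_sum fun i hi => (le_of_abs_le (hC i x)).trans ?_
          have hx' := mem_ball_iff_norm.1 hx
          have hd := hdist i hi
          have := norm_sub_le_norm_sub_add_norm_sub (a i) x (a j)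
          rw [norm_sub_rev (a i) x] at this
          have hC0i := hC0 i
          refine div_le_div_of_nonneg_left hC0i (by positivity) ?_
          gcongr
          linarith
        have h2 : Real.sin (Real.pi / 2 * χ x) ^ 2 ≤ 1 := Real.sin_sq_le_one _
        have h3 := sq_nonneg (Real.sin (Real.pi / 2 * χ x))
        calc _ ≤ (∑ i ∈ I, C i / (δ / 2) ^ 2) * Real.sin (Real.pi / 2 * χ x) ^ 2 := by gcongr
          _ ≤ (∑ i ∈ I, C i / (δ / 2) ^ 2) * 1 := by gcongr
          _ = _ := mul_one _
      · have : χ x = 0 := χ.zero_of_le_dist (by simpa using hx)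
        rw [this]
        simpa using h4

end

section

variable {α : Type*} [MeasurableSpace α] {μ : Measure α} {p : ℝ}

/-- The Brezis-Lieb lemma. -/
lemma brezis_lieb (hp : 2 < p) {f : ℕ → Lp ℝ (ENNReal.ofReal p) μ}
    (g : Lp ℝ (ENNReal.ofReal p) μ) {M : ℝ} (hM : ∀ n, ∫ x, |f n x| ^ p ∂μ ≤ M)
    (hae : ∀ᵐ x ∂μ, Tendsto (fun n => f n x) atTop (𝓝 0)) :
    Tendsto (fun n => ∫ x, |(f n + g) x| ^ p ∂μ - ∫ x, |f n x| ^ p ∂μ) atTop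
      (𝓝 (∫ x, |g x| ^ p ∂μ)) := by
  have hmeas : ∀ u : Lp ℝ (ENNReal.ofReal p) μ, AEStronglyMeasurable (fun x => |u x| ^ p) μ :=
    fun u => (integrable_abs_rpow hp u).1
  have h := tendsto_integral_of_eps_dominated (μ := μ) (M := M)
    (f := fun n x => |(f n + g) x| ^ p - |f n x| ^ p - |g x| ^ p) (g := fun n x => |f n x| ^ p)
    (G := fun x => |g x| ^ p) (fun n => ((hmeas _).sub (hmeas _)).sub (hmeas _))
    (fun n => integrable_abs_rpow hp _) (fun n x => by positivity) hM (integrable_abs_rpow hp g)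
    (fun x => by positivity) (fun ε hε => ?_) ?_
  · have h1 := h.add_const (∫ x, |g x| ^ p ∂μ)
    rw [zero_add] at h1
    refine h1.congr fun n => ?_
    have i : Integrable (fun x => |(f n + g) x| ^ p - |f n x| ^ p) μ :=
      (integrable_abs_rpow hp _).sub (integrable_abs_rpow hp _)
    rw [integral_sub i (integrable_abs_rpow hp g),
      integral_sub (integrable_abs_rpow hp _) (integrable_abs_rpow hp _), sub_add_cancel]
  · obtain ⟨C, hC0, hC⟩ := abs_add_rpow_sub_bound hp hε
    refine ⟨C, hC0, fun n => ?_⟩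
    filter_upwards [Lp.coeFn_add (f n) g] with x hx
    rw [hx]
    exact hC _ _
  · filter_upwards [hae, ae_all_iff.2 fun n => Lp.coeFn_add (f n) g] with x hx hadd
    simp only [hadd, Pi.add_apply]
    have hc : Continuous fun a : ℝ => |a + g x| ^ p - |a| ^ p - |g x| ^ p := by
      have h1 : Continuous fun a : ℝ => |a| ^ p :=
        continuous_abs.rpow_const fun _ => Or.inr (by linarith)
      exact ((h1.comp (continuous_id.add continuous_const)).sub h1).sub continuous_const
    have := (hc.tendsto 0).comp hx
    simpa [Real.zero_rpow (by linarith : p ≠ 0), Function.comp_def] using this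

/-- The Brezis-Lieb lemma for the derivative of `∫ |u|^p`. -/
lemma brezis_lieb_deriv (hp : 2 < p) {f : ℕ → Lp ℝ (ENNReal.ofReal p) μ}
    (g : Lp ℝ (ENNReal.ofReal p) μ) {M : ℝ} (hM : ∀ n, ∫ x, |f n x| ^ p ∂μ ≤ M)
    (hae : ∀ᵐ x ∂μ, Tendsto (fun n => f n x) atTop (𝓝 0)) :
    Tendsto (fun n => ∫ x, |(f n + g) x| ^ (p - 2) * (f n + g) x * f n x ∂μ -
      ∫ x, |f n x| ^ p ∂μ) atTop (𝓝 0) := by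
  have h := tendsto_integral_of_eps_dominated (μ := μ) (M := M)
    (f := fun n x => |(f n + g) x| ^ (p - 2) * (f n + g) x * f n x - |f n x| ^ p)
    (g := fun n x => |f n x| ^ p) (G := fun x => |g x| ^ p)
    (fun n => (integrable_abs_rpow_mul_mul hp _ _).1.sub (integrable_abs_rpow hp _).1)
    (fun n => integrable_abs_rpow hp _) (fun n x => by positivity) hM (integrable_abs_rpow hp g)
    (fun x => by positivity) (fun ε hε => ?_) ?_
  · refine h.congr fun n => ?_
    rw [integral_sub (integrable_abs_rpow_mul_mul hp _ _) (integrable_abs_rpow hp _)]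
  · obtain ⟨C, hC0, hC⟩ := abs_add_rpow_mul_bound hp hε
    refine ⟨C, hC0, fun n => ?_⟩
    filter_upwards [Lp.coeFn_add (f n) g] with x hx
    rw [hx]
    exact hC _ _
  · filter_upwards [hae, ae_all_iff.2 fun n => Lp.coeFn_add (f n) g] with x hx hadd
    simp only [hadd, Pi.add_apply]
    have hc : Continuous fun a : ℝ => |a + g x| ^ (p - 2) * (a + g x) * a - |a| ^ p := by
      have h1 : Continuous fun a : ℝ => |a| ^ p :=
        continuous_abs.rpow_const fun _ => Or.inr (by linarith)
      exact (((continuous_abs_rpow_mul hp).comp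
        (continuous_id.add continuous_const)).mul continuous_id).sub h1
    have := (hc.tendsto 0).comp hx
    simpa [Real.zero_rpow (by linarith : p ≠ 0), Function.comp_def] using this

/-- The energy threshold forces the limit of the critical norms to vanish. -/
lemma eq_zero_of_threshold {d m Λ c I : ℝ} (hd : 0 < d) (hpd : p⁻¹ = 2⁻¹ - d⁻¹) (hm : 0 ≤ m)
    (hΛ : 0 < Λ) (hI : 0 ≤ I) (h1 : m * I ^ (2 / p) ≤ Λ * I) (h2 : Λ * I ≤ d * c)
    (hc : c < 1 / d * Λ ^ (1 - d / 2) * m ^ (d / 2)) : I = 0 := by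
  by_contra hI0
  have hIpos : 0 < I := lt_of_le_of_ne hI (Ne.symm hI0)
  have e : I = I ^ (2 / d) * I ^ (2 / p) := by
    rw [← Real.rpow_add hIpos]
    have : 2 / d + 2 / p = 1 := by
      rw [div_eq_mul_inv 2 p, hpd]; ring
    rw [this, Real.rpow_one]
  have h3 : m ≤ Λ * I ^ (2 / d) := by
    have hpos : 0 < I ^ (2 / p) := Real.rpow_pos_of_pos hIpos _
    refine le_of_mul_le_mul_right ?_ hpos
    rw [mul_assoc, ← e]
    exact h1
  have h4 : m ^ (d / 2) ≤ Λ ^ (d / 2) * I := by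
    have h5 := Real.rpow_le_rpow hm h3 (by positivity : 0 ≤ d / 2)
    rw [Real.mul_rpow hΛ.le (by positivity), ← Real.rpow_mul hI] at h5
    have : 2 / d * (d / 2) = 1 := by field_simp
    rwa [this, Real.rpow_one] at h5
  have h6 : Λ ^ (1 - d / 2) * m ^ (d / 2) ≤ Λ * I := by
    calc Λ ^ (1 - d / 2) * m ^ (d / 2) ≤ Λ ^ (1 - d / 2) * (Λ ^ (d / 2) * I) := by gcongr
      _ = Λ * I := by
        rw [← mul_assoc, ← Real.rpow_add hΛ]
        norm_num
  have h7 : d * c < Λ ^ (1 - d / 2) * m ^ (d / 2) := by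
    calc d * c < d * (1 / d * Λ ^ (1 - d / 2) * m ^ (d / 2)) := by gcongr
      _ = _ := by field_simp
  linarith

variable {H : Type*} [NormedAddCommGroup H] [InnerProductSpace ℝ H] {A : H →L[ℝ] H →L[ℝ] ℝ}
  {κ : ℝ} {u : ℕ → H}

lemma tendsto_zero_of_coercive (hκ : 0 < κ) (hA : ∀ w, κ * ‖w‖ ^ 2 ≤ A w w)
    (h : Tendsto (fun n => A (u n) (u n)) atTop (𝓝 0)) : Tendsto u atTop (𝓝 0) := by
  rw [tendsto_zero_iff_norm_tendsto_zero]
  have h1 : Tendsto (fun n => ‖u n‖ ^ 2) atTop (𝓝 0) := by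
    refine squeeze_zero (fun n => sq_nonneg _) (fun n => ?_) (by simpa using h.const_mul κ⁻¹)
    rw [← div_eq_inv_mul, le_div_iff₀ hκ, mul_comm]
    exact hA _
  simpa using h1.sqrt

lemma tendsto_dual_apply {G : ℕ → H →L[ℝ] ℝ} (hG : Tendsto G atTop (𝓝 0)) {z : ℕ → H} {M : ℝ}
    (hz : ∀ n, ‖z n‖ ≤ M) : Tendsto (fun n => G n (z n)) atTop (𝓝 0) := by
  refine squeeze_zero_norm (fun n => ((G n).le_opNorm _).trans
    (mul_le_mul_of_nonneg_left (hz n) (norm_nonneg _))) ?_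
  simpa using hG.norm.mul_const M

/-- Palais-Smale sequences with a nonpositive coefficient of the nonlinearity tend to zero. -/
lemma tendsto_zero_of_nonpos (hκ : 0 < κ) (hA : ∀ w, κ * ‖w‖ ^ 2 ≤ A w w)
    {G : ℕ → H →L[ℝ] ℝ} (hG : Tendsto G atTop (𝓝 0)) (h : ∀ n, A (u n) (u n) ≤ G n (u n)) :
    Tendsto u atTop (𝓝 0) := by
  have hb : ∀ n, ‖u n‖ ≤ κ⁻¹ * ‖G n‖ := by
    intro n
    have h1 := (hA (u n)).trans ((h n).trans ((le_abs_self _).trans ((G n).le_opNorm (u n))))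
    rcases eq_or_lt_of_le (norm_nonneg (u n)) with h0 | h0
    · rw [← h0]; positivity
    · rw [← div_eq_inv_mul, le_div_iff₀ hκ]
      nlinarith
  rw [tendsto_zero_iff_norm_tendsto_zero]
  exact squeeze_zero (fun n => norm_nonneg _) hb (by simpa using hG.norm.const_mul κ⁻¹)

lemma exists_bound_of_quadratic {η K₁ K₂ : ℝ} (hη : 0 < η) :
    ∃ M : ℝ, ∀ x : ℝ, 0 ≤ x → η * x ^ 2 ≤ K₁ + K₂ * x → x ≤ M := by
  refine ⟨max 1 ((|K₁| + |K₂|) / η), fun x hx h => ?_⟩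
  by_cases h1 : x ≤ 1
  · exact h1.trans (le_max_left _ _)
  · refine le_trans ?_ (le_max_right _ _)
    push Not at h1
    rw [le_div_iff₀ hη]
    have h2 : η * x ^ 2 ≤ (|K₁| + |K₂|) * x := by
      nlinarith [le_abs_self K₁, le_abs_self K₂, abs_nonneg K₁]
    nlinarith

/-- Compactness of Palais-Smale sequences below the threshold, in abstract form: `A` is a coercive
form, `T` an embedding into the critical Lebesgue space, `R` a compact embedding into `L^2`. -/
theorem palais_smale_compactness [Fact (1 ≤ ENNReal.ofReal p)] [CompleteSpace H]
    [TopologicalSpace.SeparableSpace H]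
    (hp : 2 < p) {d m Λ c C : ℝ} (hd : 0 < d) (hpd : p⁻¹ = 2⁻¹ - d⁻¹) (hm : 0 ≤ m)
    (hκ : 0 < κ) (hA : ∀ w, κ * ‖w‖ ^ 2 ≤ A w w)
    (T : H →L[ℝ] Lp ℝ (ENNReal.ofReal p) μ) (R : H →L[ℝ] Lp ℝ 2 μ) (hTR : ∀ w, T w =ᵐ[μ] R w)
    (hcrit : ∀ w, m * ‖T w‖ ^ 2 - C * ‖R w‖ ^ 2 ≤ A w w)
    (hR : ∀ (z : ℕ → H) (M : ℝ), (∀ n, ‖z n‖ ≤ M) →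
      (∀ ℓ : H →L[ℝ] ℝ, Tendsto (fun n => ℓ (z n)) atTop (𝓝 0)) →
      Tendsto (fun n => R (z n)) atTop (𝓝 0))
    {G : ℕ → H →L[ℝ] ℝ} (hG : Tendsto G atTop (𝓝 0))
    (hGu : ∀ n v, G n v = A (u n) v -
      Λ * ∫ x, |T (u n) x| ^ (p - 2) * T (u n) x * T v x ∂μ)
    (hJ : Tendsto (fun n => 1 / 2 * A (u n) (u n) - Λ / p * ∫ x, |T (u n) x| ^ p ∂μ) atTop (𝓝 c))
    (hc : 0 < Λ → c < 1 / d * Λ ^ (1 - d / 2) * m ^ (d / 2)) :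
    ∃ σ : ℕ → ℕ, StrictMono σ ∧ ∃ v : H, Tendsto (fun n => u (σ n)) atTop (𝓝 v) := by
  have hGuu : ∀ n, G n (u n) = A (u n) (u n) - Λ * ∫ x, |T (u n) x| ^ p ∂μ := fun n => by
    rw [hGu]
    simp only [abs_rpow_mul_self hp]
  have hI0 : ∀ w, 0 ≤ ∫ x, |T w x| ^ p ∂μ := fun w => integral_nonneg fun x => by positivity
  by_cases hΛ : Λ ≤ 0
  · refine ⟨id, strictMono_id, 0, tendsto_zero_of_nonpos hκ hA hG fun n => ?_⟩
    have := mul_nonpos_of_nonpos_of_nonneg hΛ (hI0 (u n))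
    rw [id, hGuu]
    linarith
  push Not at hΛ
  have hp0 : p ≠ 0 := by linarith
  obtain ⟨M, hM⟩ : ∃ M, ∀ n, ‖u n‖ ≤ M := by
    obtain ⟨K₁, hK₁⟩ := hJ.bddAbove_range
    obtain ⟨K₂, hK₂⟩ := hG.norm.bddAbove_range
    obtain ⟨M, hM⟩ := exists_bound_of_quadratic (η := d⁻¹ * κ) (K₁ := K₁) (K₂ := p⁻¹ * K₂)
      (by positivity)
    refine ⟨M, fun n => hM _ (norm_nonneg _) ?_⟩
    have h1 := hK₁ (mem_range_self n)
    have h2 := hK₂ (mem_range_self n)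
    have h3 : |G n (u n)| ≤ K₂ * ‖u n‖ :=
      ((G n).le_opNorm _).trans (mul_le_mul_of_nonneg_right h2 (norm_nonneg _))
    have h4 : d⁻¹ * A (u n) (u n) = (1 / 2 * A (u n) (u n) - Λ / p * ∫ x, |T (u n) x| ^ p ∂μ) -
        p⁻¹ * G n (u n) := by
      rw [hGuu, (by rw [hpd]; ring : d⁻¹ = 1 / 2 - p⁻¹)]
      ring
    have h5 : d⁻¹ * (κ * ‖u n‖ ^ 2) ≤ d⁻¹ * A (u n) (u n) := by gcongr; exact hA _
    have h6 : p⁻¹ * -G n (u n) ≤ p⁻¹ * (K₂ * ‖u n‖) := by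
      gcongr
      exact (neg_le_abs _).trans h3
    linarith
  obtain ⟨σ₁, hσ₁, v, hv⟩ := exists_weak_subseq hM
  have hRz := hR (fun n => u (σ₁ n) - v) (M + ‖v‖)
    (fun n => (norm_sub_le _ _).trans (by linarith [hM (σ₁ n)]))
    (fun ℓ => by simpa using (hv ℓ).sub_const (ℓ v))
  obtain ⟨σ₂, hσ₂, hae⟩ := (tendstoInMeasure_of_tendsto_Lp hRz).exists_seq_tendsto_ae
  set σ : ℕ → ℕ := fun n => σ₁ (σ₂ n) with hσdef
  have hσ : StrictMono σ := hσ₁.comp hσ₂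
  set z : ℕ → H := fun n => u (σ n) - v with hz
  have hzM : ∀ n, ‖z n‖ ≤ M + ‖v‖ := fun n =>
    (norm_sub_le _ _).trans (by linarith [hM (σ n)])
  have hweak : ∀ ℓ : H →L[ℝ] ℝ, Tendsto (fun n => ℓ (z n)) atTop (𝓝 0) := fun ℓ => by
    have := ((hv ℓ).sub_const (ℓ v)).comp hσ₂.tendsto_atTop
    simpa [Function.comp_def, hz] using this
  have hTae : ∀ᵐ x ∂μ, Tendsto (fun n => T (z n) x) atTop (𝓝 0) := by
    filter_upwards [hae, ae_all_iff.2 fun n => hTR (z n),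
      Lp.coeFn_zero ℝ 2 μ] with x h1 h2 h3
    simp only [h2]
    rw [h3] at h1
    exact h1
  have hTy : ∀ n, T (u (σ n)) = T (z n) + T v := fun n => by
    rw [← map_add, hz, sub_add_cancel]
  have hIM : ∀ n, ∫ x, |T (z n) x| ^ p ∂μ ≤ (‖T‖ * (M + ‖v‖)) ^ p := fun n => by
    rw [integral_abs_rpow_eq hp]
    gcongr
    exact (T.le_opNorm _).trans (by gcongr; exact hzM n)
  have hBL := brezis_lieb hp (T v) hIM hTae
  have hBL' := brezis_lieb_deriv hp (T v) hIM hTae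
  simp only [← hTy] at hBL hBL'
  have hGu0 := (tendsto_dual_apply hG hM).comp hσ.tendsto_atTop
  have hGz := tendsto_dual_apply (hG.comp hσ.tendsto_atTop) hzM
  have hIy : Tendsto (fun n => ∫ x, |T (u (σ n)) x| ^ p ∂μ) atTop (𝓝 (d * c / Λ)) := by
    have h1 := (((hJ.comp hσ.tendsto_atTop).sub (hGu0.const_mul (1 / 2))).const_mul (d / Λ))
    have e : d / Λ * (c - 1 / 2 * 0) = d * c / Λ := by ring
    rw [e] at h1
    refine h1.congr fun n => ?_
    simp only [Function.comp_apply]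
    rw [hGuu, div_eq_mul_inv Λ p, hpd]
    field_simp
    ring
  have hIz : Tendsto (fun n => ∫ x, |T (z n) x| ^ p ∂μ) atTop
      (𝓝 (d * c / Λ - ∫ x, |T v x| ^ p ∂μ)) := by
    simpa using hIy.sub hBL
  set I := d * c / Λ - ∫ x, |T v x| ^ p ∂μ with hI
  have hAz : Tendsto (fun n => A (z n) (z n)) atTop (𝓝 (Λ * I)) := by
    have h1 := ((hGz.sub (hweak (A v))).add (hBL'.const_mul Λ)).add (hIz.const_mul Λ)
    have e : 0 - 0 + Λ * 0 + Λ * I = Λ * I := by ring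
    rw [e] at h1
    refine h1.congr fun n => ?_
    simp only [Function.comp_apply]
    have : A (z n) (z n) = A (u (σ n)) (z n) - A v (z n) := by
      rw [← sub_apply, ← map_sub]
    rw [hGu, this]
    ring
  have hI_nonneg : 0 ≤ I := ge_of_tendsto' hIz fun n => hI0 _
  have hlim : m * I ^ (2 / p) ≤ Λ * I := by
    have h1 : Tendsto (fun n => m * (∫ x, |T (z n) x| ^ p ∂μ) ^ (2 / p) - C * ‖R (z n)‖ ^ 2)
        atTop (𝓝 (m * I ^ (2 / p) - C * 0 ^ 2)) := by
      refine ((hIz.rpow_const (Or.inr (by positivity))).const_mul m).sub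
        (Tendsto.const_mul C (Tendsto.pow ?_ 2))
      have h2 := (hRz.comp hσ₂.tendsto_atTop).norm
      rw [norm_zero] at h2
      exact h2
    have h2 := le_of_tendsto_of_tendsto' h1 hAz fun n => by
      refine le_trans (le_of_eq ?_) (hcrit (z n))
      rw [integral_abs_rpow_eq hp, ← Real.rpow_mul (norm_nonneg _), mul_div_cancel₀ _ hp0,
        Real.rpow_two]
    simpa using h2
  have hIzero : I = 0 := by
    refine eq_zero_of_threshold hd hpd hm hΛ hI_nonneg hlim ?_ (hc hΛ)
    rw [hI, mul_sub, mul_div_cancel₀ _ hΛ.ne']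
    have := mul_nonneg hΛ.le (hI0 v)
    linarith
  rw [hIzero, mul_zero] at hAz
  refine ⟨σ, hσ, v, ?_⟩
  have h1 := (tendsto_zero_of_coercive hκ hA hAz).add_const v
  simpa [hz] using h1

end

section

lemma hasFDerivAt_energy {α : Type*} [MeasurableSpace α] {μ : Measure α} {p : ℝ}
    [Fact (1 ≤ ENNReal.ofReal p)] {H : Type*} [NormedAddCommGroup H] [NormedSpace ℝ H]
    (hp : 2 < p) {A : H →L[ℝ] H →L[ℝ] ℝ} (hA : ∀ w v, A w v = A v w)
    (T : H →L[ℝ] Lp ℝ (ENNReal.ofReal p) μ) (Λ : ℝ) (w : H)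
    {P : Lp ℝ (ENNReal.ofReal p) μ →L[ℝ] ℝ}
    (hP : ∀ v, P v = ∫ x, |T w x| ^ (p - 2) * T w x * v x ∂μ) :
    HasFDerivAt (fun w => 1 / 2 * A w w - Λ / p * ∫ x, |T w x| ^ p ∂μ) (A w - Λ • P.comp T) w := by
  have h1 := (A.hasFDerivAt_of_bilinear (hasFDerivAt_id w) (hasFDerivAt_id w)).const_mul (1 / 2)
  have h2 := ((hasFDerivAt_integral_abs_rpow hp (T w) hP).comp w T.hasFDerivAt).const_mul (Λ / p)
  refine (h1.sub h2).congr_fderiv ?_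
  ext v
  have hp0 : p ≠ 0 := by linarith
  simp [ContinuousLinearMap.precompR_apply, ContinuousLinearMap.precompL_apply, hA v w]
  field_simp
  ring

lemma exists_symm_form {E F : Type*} [NormedAddCommGroup E] [NormedSpace ℝ E]
    [NormedAddCommGroup F] [InnerProductSpace ℝ F] {k : ℕ} (S : E →L[ℝ] F)
    {B : Fin k → E →L[ℝ] E →L[ℝ] ℝ} (hB : ∀ i w v, B i w v = B i v w) :
    ∃ A : E →L[ℝ] E →L[ℝ] ℝ, (∀ w v, A w v = A v w) ∧
      ∀ w, ‖S w‖ ^ 2 - ∑ i, B i w w = A w w := by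
  let D : E →L[ℝ] E →L[ℝ] ℝ := (innerSL ℝ (E := F)).bilinearComp S S
  have hD : ∀ w v, D w v = inner ℝ (S w) (S v) := fun _ _ => rfl
  refine ⟨D - ∑ i, B i, fun w v => ?_, fun w => ?_⟩
  · simp only [sub_apply, sum_apply, hD]
    rw [real_inner_comm]
    congr 1
    exact Finset.sum_congr rfl fun i _ => hB i w v
  · simp only [sub_apply, sum_apply, hD,
      real_inner_self_eq_norm_sq]

instance secondCountableTopology_pairSpace (N : ℕ) :
    SecondCountableTopology (PairSpace N 2) := by
  have : Fact ((2 : ℝ≥0∞) ≠ ⊤) := ⟨by simp⟩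
  have h1 : SecondCountableTopology (Lp ℝ 2 (volume : Measure (Euc N))) := inferInstance
  have h2 : SecondCountableTopology (Lp (Euc N) 2 (volume : Measure (Euc N))) := inferInstance
  exact (WithLp.prodContinuousLinearEquiv 2 ℝ (Lp ℝ 2 (volume : Measure (Euc N)))
    (Lp (Euc N) 2 (volume : Measure (Euc N)))).toHomeomorph.isEmbedding.secondCountableTopology

instance separableSpace_H10 (N : ℕ) (Ω : Set (Euc N)) :
    TopologicalSpace.SeparableSpace (H10 N Ω) := by
  have : SecondCountableTopology (H10 N Ω) :=
    TopologicalSpace.Subtype.secondCountableTopology _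
  infer_instance

lemma setIntegral_rpow_fst {N : ℕ} {Ω : Set (Euc N)} [Fact (3 ≤ N)] (w : H10 N Ω) :
    ∫ x in Ω, |w.1.fst x| ^ twoStar N = ∫ x, |w.1.fst x| ^ twoStar N := by
  refine setIntegral_eq_integral_of_ae_compl_eq_zero ?_
  filter_upwards [fst_eq_zero_off w] with x hx hxΩ
  rw [hx hxΩ, abs_zero, Real.zero_rpow (by linarith [two_lt_twoStar N])]

variable {N k : ℕ} {Ω : Set (Euc N)} [Fact (3 ≤ N)]

lemma exists_critical_embedding (N : ℕ) (Ω : Set (Euc N)) [Fact (3 ≤ N)] :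
    ∃ T : H10 N Ω →L[ℝ] Lp ℝ (ENNReal.ofReal (twoStar N)) (volume : Measure (Euc N)),
      ∀ w, T w =ᵐ[volume] w.1.fst := by
  obtain ⟨C, -, hC⟩ := exists_sobolev N
  choose T hT _ using exists_mulCLM (Ω := Ω) (g := fun _ => 1) measurable_const
    (fun φ hφ => hC φ (hφ.mono (subset_univ _))) 2
  exact ⟨T, fun w => (hT w).trans (Eventually.of_forall fun x => one_mul _)⟩

/-- Poincaré's inequality. -/
lemma exists_poincare (hΩ : Bornology.IsBounded Ω) :
    ∃ C, 0 ≤ C ∧ ∀ w : H10 N Ω, ‖w.1.fst‖ ≤ C * ‖w.1.snd‖ := by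
  have h3 : 3 ≤ N := Fact.out
  set K := eLpNormLESNormFDerivOfLeConst ℝ (volume : Measure (Euc N)) Ω 2 2
  have hK : ∀ φ, IsTest Ω φ → eLpNorm (fun x => 1 * φ x) 2 volume ≤
      ENNReal.ofReal (K : ℝ) * eLpNorm (fun x => ∇ φ x) 2 volume := by
    intro φ hφ
    have := eLpNorm_le_eLpNorm_fderiv (volume : Measure (Euc N)) (u := φ) (s := Ω) (p := 2)
      (hφ.smooth.of_le (by simp)) ((subset_tsupport φ).trans hφ.supp) (by simp)
      (by simp; exact_mod_cast h3) hΩ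
    simp only [one_mul, ENNReal.ofReal_coe_nnreal]
    refine this.trans_eq ?_
    congr 1
    exact eLpNorm_congr_norm_ae (Eventually.of_forall fun x => (norm_gradient φ x).symm)
  refine ⟨K, NNReal.coe_nonneg _, fun w => ?_⟩
  have h := eLpNorm_mul_fst_le measurable_const hK w
  simp only [one_mul] at h
  have h2 := ENNReal.toReal_mono
    (ENNReal.mul_ne_top ENNReal.ofReal_ne_top (Lp.eLpNorm_ne_top _)) h
  rwa [ENNReal.toReal_mul, ENNReal.toReal_ofReal (NNReal.coe_nonneg _), ← Lp.norm_def,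
    ← Lp.norm_def] at h2

set_option maxHeartbeats 2000000 in
/-- `Q_Ω` is a bounded quadratic form. -/
lemma exists_form {a : Fin k → Euc N} {h : Fin k → Sph N → ℝ} (hh : ∀ i, Continuous (h i)) :
    ∃ A : H10 N Ω →L[ℝ] H10 N Ω →L[ℝ] ℝ, (∀ w v, A w v = A v w) ∧ ∀ w, formQ Ω a h w = A w w := by
  choose B hBs hB _ using fun i => (isHardyPotential_angular (hh i) (a i)).exists_form 2 Ω
  choose A hAs hA using exists_symm_form (sndCLM N Ω 2) hBs
  refine ⟨A, hAs, fun w => ?_⟩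
  rw [← hA, formQ, setIntegral_snd, sndCLM_apply]
  congr 1
  refine Finset.sum_congr rfl fun i _ => (integral_congr_ae ?_).trans (hB i w w).symm
  exact Eventually.of_forall fun x => by simp only; ring

/-- The inclusion of `H^1_0(Ω)` in `D^{1,2}(ℝ^N)`. -/
lemma exists_extension (w : H10 N Ω) :
    ∃ v : D12 N, v.1.fst =ᵐ[volume] w.1.fst ∧ v.1.snd = w.1.snd := by
  choose T hT using exists_critical_embedding N Ω
  obtain ⟨φ, v, hv, hlim⟩ := exists_seq_isPair w
  let E : H10 N Ω → PairSpace N (ENNReal.ofReal (twoStar N)) :=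
    fun w => WithLp.toLp 2 (T w, w.1.snd)
  have hE : Continuous E := (WithLp.prod_continuous_toLp 2 _ _).comp
    (T.continuous.prodMk (sndCLM N Ω 2).continuous)
  have hmem : E w ∈ D12 N := by
    refine mem_closure_of_tendsto ((hE.tendsto w).comp hlim) (Eventually.of_forall fun n => ?_)
    exact (IsPair.mem ⟨(hv n).test.mono (subset_univ _), (hT (v n)).trans (hv n).fst, (hv n).snd⟩)
  exact ⟨⟨E w, hmem⟩, hT w, rfl⟩

lemma wholeS_le_domainS {a : Fin k → Euc N} {h : Fin k → Sph N → ℝ}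
    [Nonempty {w : H10 N Ω // w ≠ 0}]
    (hb : BddBelow (Set.range fun w : {w : D12 N // w ≠ 0} => wholeQuotient a h w.1)) :
    wholeS a h ≤ domainS Ω a h := by
  refine le_ciInf fun w => ?_
  obtain ⟨v, hv1, hv2⟩ := exists_extension w.1
  have hv0 : v ≠ 0 := by
    rintro rfl
    apply w.2
    have h2 : w.1.1.snd = 0 := hv2.symm
    have h1 : w.1.1.fst = 0 := by
      refine Lp.ext ?_
      filter_upwards [hv1, Lp.coeFn_zero ℝ (ENNReal.ofReal (twoStar N))
        (volume : Measure (Euc N)), Lp.coeFn_zero ℝ 2 (volume : Measure (Euc N))] with x e1 e2 e3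
      rw [← e1, e3]
      exact e2
    have : ‖w.1.1‖ ^ 2 = 0 := by
      rw [WithLp.prod_norm_sq_eq_of_L2, h1, h2]
      simp
    exact Subtype.ext (norm_eq_zero.1 (by simpa using this))
  refine (ciInf_le hb ⟨v, hv0⟩).trans_eq ?_
  rw [wholeQuotient, formQ, setIntegral_snd, setIntegral_rpow_fst, hv2, norm_sq_Lp_two]
  congr 2
  · refine Finset.sum_congr rfl fun i _ => integral_congr_ae ?_
    filter_upwards [hv1] with x hx
    rw [hx]
  · refine integral_congr_ae ?_
    filter_upwards [hv1] with x hx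
    rw [hx]

/-- The critical bound on `H^1_0(Ω)`. -/
lemma exists_critical_bound {a : Fin k → Euc N} (ha : Function.Injective a)
    {h : Fin k → Sph N → ℝ} (hh : ∀ i, Continuous (h i))
    (h0 : ∀ i φ, IsTest univ φ → 0 ≤ schrodingerForm (angularPotential (h i)) φ)
    {A : H10 N Ω →L[ℝ] H10 N Ω →L[ℝ] ℝ} (hA : ∀ w, formQ Ω a h w = A w w)
    {T : H10 N Ω →L[ℝ] Lp ℝ (ENNReal.ofReal (twoStar N)) (volume : Measure (Euc N))}
    (hT : ∀ w, T w =ᵐ[volume] w.1.fst) :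
    ∃ C, ∀ w : H10 N Ω, minS h * ‖T w‖ ^ 2 - C * ‖fstCLM N Ω 2 w‖ ^ 2 ≤ A w w := by
  have hp := two_lt_twoStar N
  obtain ⟨C, -, hC⟩ := hasCriticalBound_sum ha hh h0 Finset.univ
  refine ⟨C, closure_induction (isClosed_le ?_ ?_) fun w φ hw => ?_⟩
  · exact ((T.continuous.norm.pow 2).const_mul _).sub
      (((fstCLM N Ω 2).continuous.norm.pow 2).const_mul _)
  · exact A.continuous.clm_apply continuous_id
  · have hφ := hw.test.mono (subset_univ _)
    have e1 : ‖T w‖ ^ 2 = critSq φ := by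
      rw [← critSq_congr ((hT w).trans hw.fst), critSq, integral_abs_rpow_eq hp,
        ← Real.rpow_mul (norm_nonneg _), mul_div_cancel₀ _ (by linarith), Real.rpow_two]
    have e2 : ‖fstCLM N Ω 2 w‖ ^ 2 = ∫ x, φ x ^ 2 := by
      rw [norm_sq_Lp_two]
      refine integral_congr_ae ?_
      filter_upwards [hw.fst] with x hx
      rw [fstCLM_apply, hx, Real.norm_eq_abs, sq_abs]
    have hi : ∀ i, Integrable fun x => angularPotential (h i) (x - a i) * φ x ^ 2 :=
      fun i => (isHardyPotential_angular (hh i) (a i)).integrable hφ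
    have e3 : A w w = schrodingerForm (fun x => ∑ i, angularPotential (h i) (x - a i)) φ := by
      rw [← hA, hw.formQ_eq, schrodingerForm_eq hφ]
      · simp only [Finset.sum_mul]
        rw [integral_finsetSum _ fun i _ => hi i]
      · simp only [Finset.sum_mul]
        exact integrable_finsetSum _ fun i _ => hi i
    rw [e1, e2, e3]
    exact hC φ hφ

lemma exists_coercive (hΩ : Bornology.IsBounded Ω) {a : Fin k → Euc N} {h : Fin k → Sph N → ℝ}
    (hQ : FormPosDef Ω a h) : ∃ κ, 0 < κ ∧ ∀ w : H10 N Ω, κ * ‖w‖ ^ 2 ≤ formQ Ω a h w := by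
  obtain ⟨c, hc, hcQ⟩ := hQ
  obtain ⟨K, hK0, hK⟩ := exists_poincare hΩ
  refine ⟨c / (K ^ 2 + 1), by positivity, fun w => le_trans ?_ (hcQ w)⟩
  rw [setIntegral_snd]
  have h1 : ‖w‖ ^ 2 = ‖w.1.fst‖ ^ 2 + ‖w.1.snd‖ ^ 2 := WithLp.prod_norm_sq_eq_of_L2 w.1
  have h2 : ‖w.1.fst‖ ^ 2 ≤ K ^ 2 * ‖w.1.snd‖ ^ 2 := by
    rw [← mul_pow]
    gcongr
    exact hK w
  rw [div_mul_eq_mul_div, div_le_iff₀ (by positivity), h1, mul_assoc]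
  gcongr
  linarith

end

end MultiHardy

end

theorem mainTheorem8 {N k : ℕ} [Fact (3 ≤ N)] (Ω : Set (Euc N)) (hΩ : IsBoundedSmoothDomain Ω)
    (a : Fin k → Euc N) (ha : Function.Injective a) (haΩ : ∀ i, a i ∈ Ω)
    (h : Fin k → Sph N → ℝ) (hh : ∀ i, ContMDiff (𝓡 (N - 1)) 𝓘(ℝ, ℝ) 1 (h i))
    (hQ : FormPosDef Ω a h)
    (Λ : ℝ)
    (hΛ : Λ = domainS Ω a h ∨
      (BddBelow (Set.range fun w : {w : D12 N // w ≠ 0} => wholeQuotient a h w.1) ∧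
        Λ = wholeS a h))
    (u : ℕ → H10 N Ω) (c : ℝ)
    (hJ : Tendsto (fun n => energyJ Ω a h Λ (u n)) atTop (𝓝 c))
    (hJ' : Tendsto (fun n => fderiv ℝ (energyJ Ω a h Λ) (u n)) atTop (𝓝 0))
    (hc : c < 1 / N * domainS Ω a h ^ (1 - (N : ℝ) / 2) * minS h ^ ((N : ℝ) / 2)) :
    ∃ σ : ℕ → ℕ, StrictMono σ ∧ ∃ v : H10 N Ω, Tendsto (fun n => u (σ n)) atTop (𝓝 v) := by
  have hp := two_lt_twoStar N
  have hN := three_le N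
  have hcont : ∀ i, Continuous (h i) := fun i => (hh i).continuous
  have h0 : ∀ i φ, IsTest univ φ → 0 ≤ schrodingerForm (angularPotential (h i)) φ :=
    fun i φ hφ => schrodingerForm_nonneg hΩ.isOpen ha haΩ hcont hQ i hφ
  have hm : 0 ≤ minS h := minS_nonneg hcont h0
  rcases isEmpty_or_nonempty {w : H10 N Ω // w ≠ 0} with he | hne
  · have hu : ∀ n, u n = 0 := fun n => by
      by_contra hn
      exact he.false ⟨u n, hn⟩
    exact ⟨id, strictMono_id, 0, by simp [hu]⟩
  have hΛS : Λ ≤ domainS Ω a h := by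
    rcases hΛ with rfl | ⟨hb, rfl⟩
    · exact le_rfl
    · exact wholeS_le_domainS hb
  choose T hT using exists_critical_embedding N Ω
  choose A hAs hA using exists_form (Ω := Ω) (a := a) hcont
  obtain ⟨κ, hκ, hκQ⟩ := exists_coercive hΩ.isBounded hQ
  obtain ⟨C, hC⟩ := exists_critical_bound ha hcont h0 hA hT
  choose P hP using exists_powerCLM (μ := (volume : Measure (Euc N))) hp
  have hJeq : energyJ Ω a h Λ =
      fun w => 1 / 2 * A w w - Λ / twoStar N * ∫ x, |T w x| ^ twoStar N := by
    ext w
    rw [energyJ, hA, setIntegral_rpow_fst]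
    congr 2
    refine integral_congr_ae ?_
    filter_upwards [hT w] with x hx
    rw [hx]
  rw [hJeq] at hJ hJ'
  have hfd : ∀ w, fderiv ℝ (fun w => 1 / 2 * A w w - Λ / twoStar N * ∫ x, |T w x| ^ twoStar N) w =
      A w - Λ • (P (T w)).comp T := fun w => (hasFDerivAt_energy hp hAs T Λ w (hP (T w))).fderiv
  simp only [hfd] at hJ'
  refine palais_smale_compactness hp (d := N) (by linarith) (inv_twoStar N) hm hκ
    (fun w => (hκQ w).trans_eq (hA w)) T (fstCLM N Ω 2) hT hC
    (fun z M hz hw => rellich hΩ.isBounded hz hw) hJ' (fun n v => ?_) hJ fun hΛ0 => hc.trans_le ?_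
  · simp [hP]
  · have := Real.antitoneOn_rpow_Ioi_of_exponent_nonpos (by linarith : 1 - (N : ℝ) / 2 ≤ 0)
      (mem_Ioi.2 hΛ0) (mem_Ioi.2 (hΛ0.trans_le hΛS)) hΛS
    gcongr
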